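/- Let $\Lambda$ be a finite $k$-graph with no sources: a countable small category with degree functor $d:\Lambda\to\mathbb N^k$ having the unique factorization property, with every $\Lambda^n=d^{-1}(n)$ finite and every $v\Lambda^n=\{\lambda\in\Lambda^n: r(\lambda)=v\}$ ($v\in\Lambda^0$, $n\in\mathbb N^k$) nonempty. Let $\Lambda^\infty$ be its infinite path space, i.e. the set of degree-preserving functors $x:\Omega_k\to\Lambda$, where $\Omega_k$ is the $k$-graph of pairs $p\le q$ in $\mathbb N^k$ with $d(p,q)=q-p$. It carries the topology generated by the cylinder sets $Z(\lambda)=\{x: x(0,d(\lambda))=\lambda\}$ and the Borel $\sigma$-algebra. Let $\sigma_\lambda:Z(s(\lambda))\to Z(\lambda)$, $\sigma_\lambda(x)=\lambda x$, and $\sigma^n:\Lambda^\infty\to\Lambda^\infty$, $\sigma^n(x)(p,q)=x(p+n,q+n)$, be the standard prefixing and coding maps. Let $\mu,\mu'$ be Borel measures on $\Lambda^\infty$ and $\{f_\lambda\}_{\lambda\in\Lambda}\subseteq L^2(\Lambda^\infty,\mu)$, $\{f'_\lambda\}_{\lambda\in\Lambda}\subseteq L^2(\Lambda^\infty,\mu')$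 families of (a.e.) non-negative functions such that the maps $\{\sigma_\lambda\},\{\sigma^n\}$ together with $\{f_\lambda\}$, respectively $\{f'_\lambda\}$, form a $\Lambda$-projective system on $(\Lambda^\infty,\mu)$, respectively $(\Lambda^\infty,\mu')$. For $\mu$ this means the following, and likewise for $\mu'$: (i) $\{\sigma_\lambda\},\{\sigma^n\}$ is a $\Lambda$-semibranching function system on $(\Lambda^\infty,\mu)$; for these maps this amounts to $\mu(Z(v))>0$ for every $v\in\Lambda^0$ and to the existence, for every $\lambda\in\Lambda$, of the Radon--Nikodym derivative $\frac{d(\mu\circ\sigma_\lambda)}{d\mu}$ on $Z(s(\lambda))$, which is $>0$ $\mu$-a.e. there; (ii) for every $\lambda\in\Lambda$, $\frac{d(\mu\circ\sigma_\lambda^{-1})}{d\mu}=|f_\lambda|^2$ $\mu$-a.e. on $\Lambda^\infty$ (so $f_\lambda=0$ a.e. off $Z(\lambda)$), and this is nonzero $\mu$-a.e. on $Z(\lambda)$; (iii) $f_\lambda\cdot(f_\nu\circ\sigma^{d(\lambda)})=f_{\lambda\nu}$ $\mu$-a.e. whenever $s(\lambda)=r(\nu)$. Let $C^*(\Lambda)$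 be the universal $C^*$-algebra generated by a Cuntz--Krieger $\Lambda$-family $\{t_\lambda\}_{\lambda\in\Lambda}$. Then there are unique representations $\pi$ of $C^*(\Lambda)$ on $L^2(\Lambda^\infty,\mu)$ and $\pi'$ of $C^*(\Lambda)$ on $L^2(\Lambda^\infty,\mu')$ with $$\pi(t_\lambda)\xi=f_\lambda\cdot(\xi\circ\sigma^{d(\lambda)}),\qquad \pi'(t_\lambda)\xi=f'_\lambda\cdot(\xi\circ\sigma^{d(\lambda)})\qquad(\lambda\in\Lambda),$$ and $\pi$ and $\pi'$ are disjoint (no nonzero subrepresentation of $\pi$ is unitarily equivalent to a subrepresentation of $\pi'$) if and only if $\mu$ and $\mu'$ are mutually singular. -/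

import Mathlib

open MeasureTheory
open scoped ENNReal NNReal ComplexOrder

universe u

/-! ## Higher-rank graphs -/

/-- A `k`-graph in the arrows-only picture: a countable small category whose set of arrows is `Λ`
(objects are identified with identity arrows), with range `r`, source `s`, degree functor
`deg : Λ → ℕ^k`, and the factorization property.  The composite `comp a b` is written `a b` in the
comments; it is only meaningful for composable pairs, `s a = r b`, and nothing is assumed (or ever
used) about it for other pairs. -/
class KGraph (k : outParam ℕ) (Λ : Type u) where
  r : Λ → Λ
  s : Λ → Λ
  comp : Λ → Λ → Λ
  deg : Λ → (Fin k → ℕ)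
  countable : Countable Λ
  r_r : ∀ a, r (r a) = r a
  s_r : ∀ a, s (r a) = r a
  r_s : ∀ a, r (s a) = s a
  s_s : ∀ a, s (s a) = s a
  r_comp : ∀ a b, s a = r b → r (comp a b) = r a
  s_comp : ∀ a b, s a = r b → s (comp a b) = s b
  id_comp : ∀ a, comp (r a) a = a
  comp_id : ∀ a, comp a (s a) = a
  assoc : ∀ a b c, s a = r b → s b = r c → comp (comp a b) c = comp a (comp b c)
  deg_id : ∀ a, deg (r a) = 0
  deg_comp : ∀ a b, s a = r b → deg (comp a b) = deg a + deg b
  factorization : ∀ (a : Λ) (m n : Fin k → ℕ), deg a = m + n →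
    ∃! p : Λ × Λ, s p.1 = r p.2 ∧ comp p.1 p.2 = a ∧ deg p.1 = m ∧ deg p.2 = n

namespace KGraph

variable {k : ℕ} {Λ : Type u} [KGraph k Λ]

/-- The set `Λ^n` of arrows of degree `n`; in particular `Λ^0` is the set of vertices. -/
def paths (Λ : Type u) [KGraph k Λ] (n : Fin k → ℕ) : Set Λ := {a | deg a = n}

/-- `v Λ^n`: the arrows of degree `n` with range `v`. -/
def pathsFrom (v : Λ) (n : Fin k → ℕ) : Set Λ := {a | r a = v ∧ deg a = n}

/-- `Λ` is finite: every `Λ^n` is a finite set. -/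
def IsFinite (Λ : Type u) [KGraph k Λ] : Prop := ∀ n : Fin k → ℕ, (paths Λ n).Finite

/-- `Λ` has no sources: `v Λ^n` is nonempty for every vertex `v` and every `n`. -/
def NoSources (Λ : Type u) [KGraph k Λ] : Prop :=
  ∀ v ∈ paths Λ (0 : Fin k → ℕ), ∀ n, (pathsFrom v n).Nonempty

theorem exists_factor (a : Λ) (m : Fin k → ℕ) (h : m ≤ deg a) :
    ∃ p : Λ × Λ, s p.1 = r p.2 ∧ comp p.1 p.2 = a ∧ deg p.1 = m ∧ deg p.2 = deg a - m :=
  (factorization a m (deg a - m) (add_tsub_cancel_of_le h).symm).exists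

open Classical in
/-- For `m ≤ deg a`, the initial segment `a(0,m)`. -/
noncomputable def take (a : Λ) (m : Fin k → ℕ) : Λ :=
  if h : m ≤ deg a then (exists_factor a m h).choose.1 else a

open Classical in
/-- For `m ≤ deg a`, the final segment `a(m, deg a)`. -/
noncomputable def drop (a : Λ) (m : Fin k → ℕ) : Λ :=
  if h : m ≤ deg a then (exists_factor a m h).choose.2 else a

theorem take_drop_spec (a : Λ) (m : Fin k → ℕ) (h : m ≤ deg a) :
    s (take a m) = r (drop a m) ∧ comp (take a m) (drop a m) = a ∧ deg (take a m) = m ∧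
      deg (drop a m) = deg a - m := by
  unfold take drop
  rw [dif_pos h, dif_pos h]
  exact (exists_factor a m h).choose_spec

theorem comp_unique (a b a' b' : Λ) (h : s a = r b) (h' : s a' = r b') (hd : deg a = deg a')
    (he : comp a b = comp a' b') : a = a' ∧ b = b' := by
  have hdb : deg b = deg b' := by
    have h1 := deg_comp a b h
    have h2 := deg_comp a' b' h'
    rw [he, h2, hd] at h1
    exact (add_left_cancel h1).symm
  have := (factorization (comp a b) (deg a) (deg b) (deg_comp a b h)).unique
    (y₁ := (a, b)) (y₂ := (a', b')) ⟨h, rfl, rfl, rfl⟩ ⟨h', he.symm, hd.symm, hdb.symm⟩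
  exact Prod.mk.inj this

theorem take_drop_comp (a b : Λ) (h : s a = r b) :
    take (comp a b) (deg a) = a ∧ drop (comp a b) (deg a) = b := by
  have hle : deg a ≤ deg (comp a b) := by rw [deg_comp a b h]; exact le_self_add
  obtain ⟨h1, h2, h3, -⟩ := take_drop_spec (comp a b) (deg a) hle
  exact comp_unique _ _ _ _ h1 h h3 h2

theorem take_comp_of_le (a b : Λ) (h : s a = r b) (m : Fin k → ℕ) (hm : m ≤ deg a) :
    take (comp a b) m = take a m := by
  obtain ⟨h1, h2, h3, -⟩ := take_drop_spec a m hm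
  have hs : s (drop a m) = r b := by rw [← h, ← s_comp _ _ h1, h2]
  have he : comp a b = comp (take a m) (comp (drop a m) b) := by
    rw [← assoc _ _ _ h1 hs, h2]
  have := (take_drop_comp (take a m) (comp (drop a m) b) (by rw [r_comp _ _ hs, h1])).1
  rwa [← he, h3] at this

theorem eq_r_of_deg_zero (a : Λ) (h : deg a = 0) : a = r a := by
  have h0 : s (r a) = r a := s_r a
  refine ((comp_unique (r a) a a (s a) h0 (r_s a).symm ?_ ?_).1).symm
  · rw [deg_id, h]
  · rw [id_comp, comp_id]

end KGraph

/-! ## The infinite path space -/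

/-- An infinite path: a degree-preserving functor `x : Ω_k → Λ`, where `Ω_k` is the `k`-graph whose
arrows are the pairs `(p,q)` with `p ≤ q` in `ℕ^k`, with `r (p,q) = (p,p)`, `s (p,q) = (q,q)`,
`(p,q)(q,t) = (p,t)` and degree `q - p`. -/
@[ext]
structure InfinitePath (k : ℕ) (Λ : Type u) [KGraph k Λ] where
  seg : ∀ p q : Fin k → ℕ, p ≤ q → Λ
  deg_seg : ∀ p q h, KGraph.deg (seg p q h) = q - p
  r_seg : ∀ p q h, KGraph.r (seg p q h) = seg p p le_rfl
  s_seg : ∀ p q h, KGraph.s (seg p q h) = seg q q le_rfl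
  comp_seg : ∀ p q t (h : p ≤ q) (h' : q ≤ t),
    KGraph.comp (seg p q h) (seg q t h') = seg p t (h.trans h')

namespace InfinitePath

open KGraph

variable {k : ℕ} {Λ : Type u} [KGraph k Λ]

/-- The cylinder set `Z(a) = {x | x(0, deg a) = a}`. -/
def cylinder (a : Λ) : Set (InfinitePath k Λ) := {x | x.seg 0 (deg a) zero_le = a}

/-- The topology generated by the cylinder sets. -/
instance : TopologicalSpace (InfinitePath k Λ) :=
  TopologicalSpace.generateFrom (Set.range (cylinder (Λ := Λ)))

instance : MeasurableSpace (InfinitePath k Λ) := borel _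

instance : BorelSpace (InfinitePath k Λ) := ⟨rfl⟩

/-- The standard coding map `σ^m`, `σ^m(x)(p,q) = x(p+m, q+m)`. -/
def shift (m : Fin k → ℕ) (x : InfinitePath k Λ) : InfinitePath k Λ where
  seg p q h := x.seg (p + m) (q + m) (add_le_add_left h m)
  deg_seg p q h := by rw [x.deg_seg, add_tsub_add_eq_tsub_right]
  r_seg p q h := x.r_seg _ _ _
  s_seg p q h := x.s_seg _ _ _
  comp_seg p q t h h' := x.comp_seg _ _ _ _ _

/-- The infinite path with prescribed coherent initial segments `P q = x(0,q)`. -/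
noncomputable def ofInitial (P : (Fin k → ℕ) → Λ) (hd : ∀ q, deg (P q) = q)
    (hP : ∀ p q, p ≤ q → take (P q) p = P p) : InfinitePath k Λ :=
  have key : ∀ p q, p ≤ q → s (P p) = r (drop (P q) p) ∧ comp (P p) (drop (P q) p) = P q ∧
      deg (drop (P q) p) = q - p := by
    intro p q h
    obtain ⟨h1, h2, -, h4⟩ := take_drop_spec (P q) p (by rw [hd]; exact h)
    rw [hP p q h] at h1 h2
    exact ⟨h1, h2, by rw [h4, hd]⟩
  have diag : ∀ p, drop (P p) p = s (P p) := by
    intro p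
    obtain ⟨h1, -, h3⟩ := key p p le_rfl
    rw [eq_r_of_deg_zero (drop (P p) p) (by rw [h3, tsub_self]), h1]
  { seg := fun p q _ => drop (P q) p
    deg_seg := fun p q h => (key p q h).2.2
    r_seg := fun p q h => by rw [← (key p q h).1, diag]
    s_seg := fun p q h => by
      rw [diag, ← s_comp _ _ (key p q h).1, (key p q h).2.1]
    comp_seg := fun p q t h h' => by
      obtain ⟨a1, a2, a3⟩ := key p q h
      obtain ⟨b1, b2, b3⟩ := key q t h'
      obtain ⟨c1, c2, c3⟩ := key p t (h.trans h')
      have hs : s (drop (P q) p) = r (drop (P t) q) := by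
        rw [← b1, ← a2, s_comp _ _ a1, a2]
      refine (comp_unique (P p) _ (P p) _ ?_ c1 rfl ?_).2
      · rw [r_comp _ _ hs, a1]
      · rw [← assoc _ _ _ a1 hs, a2, b2, c2] }

theorem r_seg_of_mem (a : Λ) (x : InfinitePath k Λ) (hx : x ∈ cylinder (s a)) (q : Fin k → ℕ) :
    s a = r (x.seg 0 q zero_le) := by
  have h0 : deg (s a) = 0 := by rw [← r_s, deg_id]
  have h : x.seg 0 (deg (s a)) zero_le = s a := hx
  rw [x.r_seg]
  have : ∀ (n : Fin k → ℕ) (hn : n = 0), x.seg 0 n zero_le = x.seg 0 0 le_rfl := by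
    rintro n rfl; rfl
  rw [← this _ h0, h]

/-- The standard prefixing map `σ_a : Z(s(a)) → Λ^∞`, `σ_a(x) = a x`: the infinite path whose
initial segment of degree `q` is the initial segment of degree `q` of the finite path
`a x(0,q)`. -/
noncomputable def prepend (a : Λ) (x : cylinder (k := k) (s a)) : InfinitePath k Λ :=
  ofInitial (fun q => take (comp a (x.1.seg 0 q zero_le)) q)
    (fun q => by
      refine (take_drop_spec _ q ?_).2.2.1
      rw [deg_comp _ _ (r_seg_of_mem a x.1 x.2 q), x.1.deg_seg, tsub_zero]
      exact le_add_self)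
    (fun p q h => by
      have hr := fun q => r_seg_of_mem a x.1 x.2 q
      have hp : p ≤ deg (comp a (x.1.seg 0 p zero_le)) := by
        rw [deg_comp _ _ (hr p), x.1.deg_seg, tsub_zero]; exact le_add_self
      have hq : q ≤ deg (comp a (x.1.seg 0 q zero_le)) := by
        rw [deg_comp _ _ (hr q), x.1.deg_seg, tsub_zero]; exact le_add_self
      have e1 : comp a (x.1.seg 0 q zero_le) =
          comp (comp a (x.1.seg 0 p zero_le)) (x.1.seg p q h) := by
        rw [assoc _ _ _ (hr p) (by rw [x.1.s_seg, x.1.r_seg]), x.1.comp_seg]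
      have e2 : take (comp a (x.1.seg 0 q zero_le)) p =
          take (comp a (x.1.seg 0 p zero_le)) p := by
        rw [e1]
        exact take_comp_of_le _ _ (by rw [s_comp _ _ (hr p), x.1.s_seg, x.1.r_seg]) _ hp
      obtain ⟨h1, h2, h3, -⟩ := take_drop_spec _ q hq
      have e3 := take_comp_of_le _ _ h1 p (by rw [h3]; exact h)
      rw [h2] at e3
      rw [← e3, e2])

/-- `a x` starts with `a`. -/
theorem prepend_mem (a : Λ) (x : cylinder (k := k) (s a)) : prepend a x ∈ cylinder a := by
  have hr := fun q => r_seg_of_mem a x.1 x.2 q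
  change drop (take (comp a (x.1.seg 0 (deg a) zero_le)) (deg a)) 0 = a
  rw [(take_drop_comp _ _ (hr _)).1]
  have := take_drop_comp (r a) a (s_r a)
  rw [id_comp, deg_id] at this
  exact this.2

/-- Chopping off the initial segment `a` of `a x` gives back `x`. -/
theorem shift_prepend (a : Λ) (x : cylinder (k := k) (s a)) : shift (deg a) (prepend a x) = x := by
  have hr := fun q => r_seg_of_mem a x.1 x.2 q
  ext p q h
  change drop (take (comp a (x.1.seg 0 (q + deg a) zero_le)) (q + deg a)) (p + deg a) = _
  have e : comp a (x.1.seg 0 (q + deg a) zero_le) =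
     comp (comp a (x.1.seg 0 q zero_le)) (x.1.seg q (q+deg a) le_self_add) := by
    rw [assoc _ _ _ (hr _) (by rw [x.1.s_seg, x.1.r_seg]), x.1.comp_seg]
  have hd : deg (comp a (x.1.seg 0 q zero_le)) = q + deg a := by
    rw [deg_comp _ _ (hr _), x.1.deg_seg, tsub_zero, add_comm]
  have e2 : take (comp a (x.1.seg 0 (q + deg a) zero_le)) (q + deg a) = comp a (x.1.seg 0 q zero_le) := by
    have := (take_drop_comp _ (x.1.seg q (q+deg a) le_self_add) (by rw [s_comp _ _ (hr q), x.1.s_seg, x.1.r_seg])).1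
    rw [← e, hd] at this
    exact this
  rw [e2]
  have e3 : comp a (x.1.seg 0 q zero_le) = comp (comp a (x.1.seg 0 p zero_le)) (x.1.seg p q h) := by
    rw [assoc _ _ _ (hr _) (by rw [x.1.s_seg, x.1.r_seg]), x.1.comp_seg]
  have hd' : deg (comp a (x.1.seg 0 p zero_le)) = p + deg a := by
    rw [deg_comp _ _ (hr _), x.1.deg_seg, tsub_zero, add_comm]
  rw [e3, ← hd']
  exact (take_drop_comp _ _ (by rw [s_comp _ _ (hr _), x.1.s_seg, x.1.r_seg])).2

end InfinitePath

/-! ## `Λ`-semibranching function systems and `Λ`-projective systems -/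

section Systems

variable {X : Type*} [MeasurableSpace X]

/-- A semibranching function system on `(X, μ)` with coding map `σ`: measurable maps
`τ i : D i → X` on measurable sets, with ranges `R i` that cover `X` and are pairwise disjoint up to
null sets, such that the Radon-Nikodym derivative `Φ = d(μ ∘ τ i)/dμ` exists and is positive almost
everywhere on `D i`, and such that `σ (τ i x) = x` on `D i`. -/
structure IsSemibranching {ι : Type*} (μ : Measure X) (D : ι → Set X) (τ : ∀ i, D i → X)
    (σ : X → X) : Prop where
  measurableSet_domain : ∀ i, MeasurableSet (D i)
  measurable_map : ∀ i, Measurable (τ i)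
  measurableSet_range : ∀ i, MeasurableSet (Set.range (τ i))
  cover : μ (⋃ i, Set.range (τ i))ᶜ = 0
  disjoint : ∀ i j, i ≠ j → μ (Set.range (τ i) ∩ Set.range (τ j)) = 0
  rnDeriv_pos : ∀ i, ∃ Φ : D i → ℝ≥0, Measurable Φ ∧
    (∀ E : Set (D i), MeasurableSet E →
      μ (τ i '' E) = ∫⁻ x in E, (Φ x : ℝ≥0∞) ∂(μ.comap Subtype.val)) ∧
    ∀ᵐ x ∂(μ.comap (Subtype.val : D i → X)), 0 < Φ x
  measurable_coding : Measurable σ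
  coding : ∀ i (x : D i), σ (τ i x) = x

variable {k : ℕ} {Λ : Type*} [KGraph k Λ]

/-- A `Λ`-semibranching function system on `(X, μ)` with domains `D`, prefixing maps `τ` and coding
maps `σ`. Statements about the partially defined maps hold up to null sets. -/
structure IsLambdaSemibranching (μ : Measure X) (D : Λ → Set X) (τ : ∀ a, D a → X)
    (σ : (Fin k → ℕ) → X → X) : Prop where
  semibranching : ∀ m : Fin k → ℕ,
    IsSemibranching μ (fun a : KGraph.paths Λ m => D a) (fun a => τ a) (σ m)
  vertex_id : ∀ v ∈ KGraph.paths Λ (0 : Fin k → ℕ), ∀ x : D v, τ v x = x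
  vertex_pos : ∀ v ∈ KGraph.paths Λ (0 : Fin k → ℕ), 0 < μ (D v)
  range_subset : ∀ a b : Λ, KGraph.s a = KGraph.r b → μ (Set.range (τ b) \ D a) = 0
  domain_comp : ∀ a b : Λ, KGraph.s a = KGraph.r b →
    ∀ᵐ x ∂μ, x ∈ D (KGraph.comp a b) ↔ x ∈ D b
  comp_ae : ∀ a b : Λ, KGraph.s a = KGraph.r b →
    ∀ᵐ x ∂μ, ∀ (hb : x ∈ D b) (ha : τ b ⟨x, hb⟩ ∈ D a) (hab : x ∈ D (KGraph.comp a b)),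
      τ a ⟨τ b ⟨x, hb⟩, ha⟩ = τ (KGraph.comp a b) ⟨x, hab⟩
  coding_add : ∀ m n : Fin k → ℕ, σ m ∘ σ n = σ (m + n)

/-- A `Λ`-projective system on `(X, μ)`: a `Λ`-semibranching function system together with
functions `f a ∈ L²(X, μ)` such that
* `d(μ ∘ τ_a⁻¹)/dμ = |f a|²`, where `(μ ∘ τ_a⁻¹)(E) = μ {x ∈ D a | τ_a x ∈ E}` for every measurable
  `E ⊆ X` (so `f a` vanishes almost everywhere off the range of `τ_a`), and this derivative is
  nonzero almost everywhere on the range of `τ_a`;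
* `f a · (f b ∘ σ^(deg a)) = f (a b)` almost everywhere, for composable `a`, `b`. -/
structure IsProjectiveSystem (μ : Measure X) (D : Λ → Set X) (τ : ∀ a, D a → X)
    (σ : (Fin k → ℕ) → X → X) (f : Λ → X → ℂ) : Prop
    extends IsLambdaSemibranching μ D τ σ where
  memLp : ∀ a, MemLp (f a) 2 μ
  rnDeriv_eq : ∀ a, ∀ E : Set X, MeasurableSet E →
    μ (Subtype.val '' (τ a ⁻¹' E)) = ∫⁻ x in E, ‖f a x‖ₑ ^ 2 ∂μ
  ne_zero : ∀ a, ∀ᵐ x ∂μ, x ∈ Set.range (τ a) → f a x ≠ 0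
  cocycle : ∀ a b, KGraph.s a = KGraph.r b →
    (fun x => f a x * f b (σ (KGraph.deg a) x)) =ᵐ[μ] f (KGraph.comp a b)

end Systems

/-! ## The `C*`-algebra of a `k`-graph -/

section CStar

variable {k : ℕ} {Λ : Type u} [KGraph k Λ]

/-- A Cuntz--Krieger `Λ`-family in a `C*`-algebra (for a row-finite `k`-graph without sources). -/
structure IsCKFamily {B : Type*} [NonUnitalCStarAlgebra B] (t : Λ → B) : Prop where
  partialIsometry : ∀ a, t a * star (t a) * t a = t a
  vertex_proj : ∀ v ∈ KGraph.paths Λ (0 : Fin k → ℕ), IsStarProjection (t v)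
  vertex_orth : ∀ v ∈ KGraph.paths Λ (0 : Fin k → ℕ), ∀ w ∈ KGraph.paths Λ (0 : Fin k → ℕ),
    v ≠ w → t v * t w = 0
  mul : ∀ a b, KGraph.s a = KGraph.r b → t a * t b = t (KGraph.comp a b)
  star_mul_self : ∀ a, star (t a) * t a = t (KGraph.s a)
  sum : ∀ v ∈ KGraph.paths Λ (0 : Fin k → ℕ), ∀ n : Fin k → ℕ,
    t v = ∑ᶠ a ∈ KGraph.pathsFrom v n, t a * star (t a)

/-- All Cuntz--Krieger `Λ`-families in `C*`-algebras (of the universe of `Λ`; as `Λ` is countable,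
a family generates a separable `C*`-algebra, so that this loses nothing). -/
structure CKFamily (k : ℕ) (Λ : Type u) [KGraph k Λ] where
  alg : Type u
  [cstar : NonUnitalCStarAlgebra alg]
  toFun : Λ → alg
  isCK : IsCKFamily toFun

attribute [instance] CKFamily.cstar

theorem IsCKFamily.norm_le_one {B : Type*} [NonUnitalCStarAlgebra B] {t : Λ → B}
    (h : IsCKFamily t) (a : Λ) : ‖t a‖ ≤ 1 := by
  have h1 : ‖star (t a) * t a‖ = ‖t a‖ * ‖t a‖ := CStarRing.norm_star_mul_self
  have h2 : ‖t a‖ ≤ ‖t a‖ * ‖t a‖ * ‖t a‖ := by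
    calc ‖t a‖ = ‖t a * (star (t a) * t a)‖ := by rw [← mul_assoc, h.partialIsometry]
      _ ≤ ‖t a‖ * ‖star (t a) * t a‖ := norm_mul_le _ _
      _ = ‖t a‖ * ‖t a‖ * ‖t a‖ := by rw [h1, mul_assoc]
  have hp : IsStarProjection (star (t a) * t a) := by
    rw [h.star_mul_self]
    exact h.vertex_proj _ (by
      change KGraph.deg (KGraph.s a) = 0
      rw [← KGraph.r_s, KGraph.deg_id])
  have h3 : ‖star (t a) * t a‖ = ‖star (t a) * t a‖ * ‖star (t a) * t a‖ := by
    have := CStarRing.norm_star_mul_self (x := star (t a) * t a)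
    rw [hp.isSelfAdjoint.star_eq, hp.isIdempotentElem.eq] at this
    exact this
  rw [h1] at h3
  nlinarith [norm_nonneg (t a), mul_nonneg (norm_nonneg (t a)) (norm_nonneg (t a))]

/-- The tuple of all `a`-th entries of Cuntz--Krieger families, in the `ℓ^∞`-product. -/
noncomputable def ckTuple (k : ℕ) {Λ : Type u} [KGraph k Λ] (a : Λ) :
    lp (fun T : CKFamily k Λ => T.alg) ∞ :=
  ⟨fun T => T.toFun a, memℓp_infty ⟨1, by
    rintro _ ⟨T, rfl⟩
    exact T.isCK.norm_le_one a⟩⟩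

/-- The `*`-subalgebra closure defining `C*(Λ)`. -/
noncomputable def kGraphSubalgebra (k : ℕ) (Λ : Type u) [KGraph k Λ] :
    NonUnitalStarSubalgebra ℂ (lp (fun T : CKFamily k Λ => T.alg) ∞) :=
  (NonUnitalStarAlgebra.adjoin ℂ (Set.range (ckTuple k (Λ := Λ)))).topologicalClosure

/-- `C*(Λ)`, the universal `C*`-algebra generated by a Cuntz--Krieger `Λ`-family: the closed
`*`-subalgebra generated by the universal family `(t_a)` inside the `ℓ^∞`-product of all
`C*`-algebras with a Cuntz--Krieger `Λ`-family. -/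
abbrev KGraphCStar (k : ℕ) (Λ : Type u) [KGraph k Λ] : Type (u + 1) := kGraphSubalgebra k Λ

noncomputable instance : NonUnitalCStarAlgebra (KGraphCStar k Λ) :=
  NonUnitalStarSubalgebra.nonUnitalCStarAlgebra (kGraphSubalgebra k Λ)
    (h_closed := NonUnitalStarSubalgebra.isClosed_topologicalClosure _)

/-- The canonical generators `t_a` of `C*(Λ)`. -/
noncomputable def KGraphCStar.gen (k : ℕ) {Λ : Type u} [KGraph k Λ] (a : Λ) : KGraphCStar k Λ :=
  ⟨ckTuple k a, NonUnitalStarSubalgebra.le_topologicalClosure _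
    (NonUnitalStarAlgebra.subset_adjoin ℂ _ ⟨a, rfl⟩)⟩

/-- The canonical generators form a Cuntz--Krieger family. -/
theorem KGraphCStar.isCKFamily_gen (hf : KGraph.IsFinite Λ) :
    IsCKFamily (KGraphCStar.gen k (Λ := Λ)) where
  partialIsometry a := Subtype.ext (Subtype.ext (funext fun T => T.isCK.partialIsometry a))
  vertex_proj v hv := ⟨Subtype.ext (Subtype.ext (funext fun T => (T.isCK.vertex_proj v hv).1)),
    Subtype.ext (Subtype.ext (funext fun T => (T.isCK.vertex_proj v hv).2))⟩
  vertex_orth v hv w hw h := Subtype.ext (Subtype.ext (funext fun T => T.isCK.vertex_orth v hv w hw h))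
  mul a b h := Subtype.ext (Subtype.ext (funext fun T => T.isCK.mul a b h))
  star_mul_self a := Subtype.ext (Subtype.ext (funext fun T => T.isCK.star_mul_self a))
  sum v hv n := by
    have hfin : (KGraph.pathsFrom v n).Finite := (hf n).subset fun a ha => ha.2
    refine Subtype.ext (Subtype.ext (funext fun T => ?_))
    let ev : KGraphCStar k Λ →+ T.alg :=
      { toFun := fun x => (x.1 : ∀ T : CKFamily k Λ, T.alg) T, map_zero' := rfl, map_add' := fun _ _ => rfl }
    change ev (KGraphCStar.gen k v) = ev _
    rw [finsum_mem_eq_finite_toFinset_sum _ hfin, map_sum]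
    have := T.isCK.sum v hv n
    rw [finsum_mem_eq_finite_toFinset_sum _ hfin] at this
    exact this

/-- Universal property (existence): a Cuntz--Krieger family in `B` is the image of the canonical
generators under a `*`-homomorphism. -/
theorem KGraphCStar.exists_lift {B : Type u} [NonUnitalCStarAlgebra B] (t : Λ → B)
    (ht : IsCKFamily t) :
    ∃ π : KGraphCStar k Λ →⋆ₙₐ[ℂ] B, ∀ a, π (KGraphCStar.gen k a) = t a :=
  ⟨{ toFun := fun x => (x.1 : ∀ T : CKFamily k Λ, T.alg) ⟨B, t, ht⟩
     map_smul' := fun _ _ => rfl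
     map_zero' := rfl
     map_add' := fun _ _ => rfl
     map_mul' := fun _ _ => rfl
     map_star' := fun _ => rfl }, fun _ => rfl⟩

end CStar

/-! ## Representations -/

section Representations

/-- Two representations of a `C*`-algebra on Hilbert spaces are disjoint if no nonzero
subrepresentation (restriction to a closed invariant subspace) of the first is unitarily equivalent
to a subrepresentation of the second. -/
def AreDisjoint {A H H' : Type*} [NonUnitalCStarAlgebra A]
    [NormedAddCommGroup H] [InnerProductSpace ℂ H] [CompleteSpace H]
    [NormedAddCommGroup H'] [InnerProductSpace ℂ H'] [CompleteSpace H']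
    (π : A →⋆ₙₐ[ℂ] (H →L[ℂ] H)) (π' : A →⋆ₙₐ[ℂ] (H' →L[ℂ] H')) : Prop :=
  ∀ (K : Submodule ℂ H) (K' : Submodule ℂ H'), IsClosed (K : Set H) → IsClosed (K' : Set H') →
    ∀ (hK : ∀ a, ∀ ξ ∈ K, π a ξ ∈ K) (_ : ∀ a, ∀ ξ ∈ K', π' a ξ ∈ K'), K ≠ ⊥ →
      ¬ ∃ U : K ≃ₗᵢ[ℂ] K', ∀ (a : A) (ξ : K),
        ((U ⟨π a ξ, hK a ξ ξ.2⟩ : K') : H') = π' a (U ξ : H')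

/-- `π` is the representation of `C*(Λ)` on `L²(X, μ)` associated to the functions `f` and the
coding maps `σ`: `π(t_a) ξ = f a · (ξ ∘ σ^(deg a))`. -/
def IsAssociatedRep {k : ℕ} {Λ : Type u} [KGraph k Λ] {X : Type*} [MeasurableSpace X]
    (μ : Measure X) (σ : (Fin k → ℕ) → X → X) (f : Λ → X → ℂ)
    (π : KGraphCStar k Λ →⋆ₙₐ[ℂ] (Lp ℂ 2 μ →L[ℂ] Lp ℂ 2 μ)) : Prop :=
  ∀ (a : Λ) (ξ : Lp ℂ 2 μ),
    (π (KGraphCStar.gen k a) ξ : X → ℂ) =ᵐ[μ] fun x => f a x * ξ (σ (KGraph.deg a) x)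

end Representations

/-! ## Weighted composition operators between `L²` spaces -/

/-! Write `S_a ξ = f_a · (ξ ∘ σ^{d(a)})`. The Radon–Nikodym condition says that `σ^{d(a)}` pushes
`|f_a|² μ` forward to `μ` restricted to `Z(s(a))` (`setLIntegral_shift_preimage`). Hence `S_a` is a
partial isometry with initial projection `1_{Z(s(a))}`. Its range projection is `1_{Z(a)}`, because
`f_a ≠ 0` there and `σ^{d(a)}` is injective on `Z(a)` (`isIndicatorMul_mul_star`). The Cuntz–Krieger
relations follow, and the universal property gives the representation.

The projections `S_a S_a*` act as `1_{Z(a)}` for every such system, whatever the measure. So if a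
unitary `U` between subrepresentations sends `ξ` to `η`, the measures `|ξ|² μ` and `|η|² μ'` agree
on all cylinders, hence are equal. If `μ ⟂ μ'`, this common measure is zero and `ξ = 0`.

Conversely, the Lebesgue decomposition gives a set `B` of full `μ'`-measure with `μ|_B = w² μ'`.
Multiplication by `w` is a partial isometry `W : L²(μ) → L²(μ')` with `W*W = 1_B`. It intertwines
the generators because `w f_a = f'_a (w ∘ σ^{d(a)})` (`weight_identity`): both sides have the same
square density, since `B` is shift-invariant up to null sets, and nonnegativity excludes a phase. It
intertwines their adjoints because it commutes with the range projections. If `W ≠ 0`, its initial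
and final spaces carry equivalent nonzero subrepresentations; so disjointness forces `W = 0`, that
is `μ(B) = 0`. -/

theorem ENNReal.eq_of_sq_eq_sq {a b : ℝ≥0∞} (h : a ^ 2 = b ^ 2) : a = b :=
  le_antisymm ((ENNReal.pow_le_pow_left_iff two_ne_zero).1 h.le)
    ((ENNReal.pow_le_pow_left_iff two_ne_zero).1 h.ge)

/-- This is where nonnegativity of the weights enters: Radon–Nikodym derivatives only see `|f|²`,
and the sign condition recovers `f`. -/
theorem eq_of_nonneg_of_enorm_sq_eq {z w : ℂ} (hz : 0 ≤ z) (hw : 0 ≤ w)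
    (h : ‖z‖ₑ ^ 2 = ‖w‖ₑ ^ 2) : z = w := by
  rw [Complex.eq_coe_norm_of_nonneg hz, Complex.eq_coe_norm_of_nonneg hw, ← toReal_enorm,
    ENNReal.eq_of_sq_eq_sq h, toReal_enorm]

section WeightedComp

variable {X Y : Type*} [MeasurableSpace X] [MeasurableSpace Y] {μ : Measure X} {ν : Measure Y}

/-- `T` is the operator `ξ ↦ w · (ξ ∘ φ)`. -/
def IsWeightedComp (T : Lp ℂ 2 μ →L[ℂ] Lp ℂ 2 ν) (w : Y → ℂ) (φ : Y → X) : Prop :=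
  ∀ ξ : Lp ℂ 2 μ, (T ξ : Y → ℂ) =ᵐ[ν] fun y => w y * ξ (φ y)

theorem IsWeightedComp.ext {S T : Lp ℂ 2 μ →L[ℂ] Lp ℂ 2 ν} {v w : Y → ℂ} {φ : Y → X}
    (hS : IsWeightedComp S v φ) (hT : IsWeightedComp T w φ) (h : v =ᵐ[ν] w) : S = T := by
  refine ContinuousLinearMap.ext fun ξ => Lp.ext ?_
  filter_upwards [hS ξ, hT ξ, h] with y h1 h2 h3
  rw [h1, h2, h3]

/-- By `hle`, the push-forward of `|w|² ν` under `φ` is at most `μ`, so preimages of `μ`-null sets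
are `ν`-null where `w ≠ 0`. Thus `w · (ξ ∘ φ)` depends only on the class of `ξ`, although `φ` itself
may fail to pull null sets back to null sets. -/
theorem ae_weight_of_ae {w : Y → ℂ} {φ : Y → X} (hw : AEStronglyMeasurable w ν)
    (hφ : Measurable φ) (hle : ∀ E, MeasurableSet E → ∫⁻ y in φ ⁻¹' E, ‖w y‖ₑ ^ 2 ∂ν ≤ μ E)
    {p : X → Prop} (hp : ∀ᵐ x ∂μ, p x) : ∀ᵐ y ∂ν, w y ≠ 0 → p (φ y) := by
  obtain ⟨N, hN, hNm, hN0⟩ := exists_measurable_superset_of_null (ae_iff.1 hp)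
  have h0 : ∫⁻ y in φ ⁻¹' N, ‖w y‖ₑ ^ 2 ∂ν = 0 := le_antisymm ((hle N hNm).trans hN0.le) zero_le
  rw [lintegral_eq_zero_iff' ((hw.enorm.pow_const 2).restrict)] at h0
  have h1 := (ae_restrict_iff' (hφ hNm)).1 h0
  filter_upwards [h1] with y hy hw0
  by_contra hpy
  have := hy (hN hpy)
  simp at this
  exact hw0 this

theorem map_withDensity_le {w : Y → ℂ} {φ : Y → X}
    (hφ : Measurable φ) (hle : ∀ E, MeasurableSet E → ∫⁻ y in φ ⁻¹' E, ‖w y‖ₑ ^ 2 ∂ν ≤ μ E) :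
    (ν.withDensity fun y => ‖w y‖ₑ ^ 2).map φ ≤ μ := by
  refine Measure.le_iff.2 fun E hE => ?_
  rw [Measure.map_apply hφ hE, withDensity_apply _ (hφ hE)]
  exact hle E hE

theorem lintegral_weighted {w : Y → ℂ} {φ : Y → X} (hw : AEStronglyMeasurable w ν)
    (hφ : Measurable φ) {g : X → ℂ} (hg : StronglyMeasurable g) :
    ∫⁻ y, ‖w y * g (φ y)‖ₑ ^ 2 ∂ν
      = ∫⁻ x, ‖g x‖ₑ ^ 2 ∂((ν.withDensity fun y => ‖w y‖ₑ ^ 2).map φ) := by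
  have hg2 : Measurable fun x => ‖g x‖ₑ ^ 2 := hg.measurable.enorm.pow_const 2
  have hg3 : Measurable fun y => ‖g (φ y)‖ₑ ^ 2 := hg2.comp hφ
  rw [lintegral_map hg2 hφ,
    lintegral_withDensity_eq_lintegral_mul₀ (hw.enorm.pow_const 2) hg3.aemeasurable]
  simp only [enorm_mul, mul_pow, Pi.mul_apply]

theorem eLpNorm_two_sq {f : X → ℂ} : eLpNorm f 2 μ ^ 2 = ∫⁻ x, ‖f x‖ₑ ^ 2 ∂μ := by
  have := eLpNorm_nnreal_pow_eq_lintegral (μ := μ) (f := f) (p := 2) (by norm_num)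
  simpa using this

theorem eLpNorm_weighted_le {w : Y → ℂ} {φ : Y → X} (hw : AEStronglyMeasurable w ν)
    (hφ : Measurable φ) (hle : ∀ E, MeasurableSet E → ∫⁻ y in φ ⁻¹' E, ‖w y‖ₑ ^ 2 ∂ν ≤ μ E)
    {g : X → ℂ} (hg : StronglyMeasurable g) :
    eLpNorm (fun y => w y * g (φ y)) 2 ν ≤ eLpNorm g 2 μ := by
  rw [← ENNReal.pow_le_pow_left_iff (n := 2) (by norm_num), eLpNorm_two_sq, eLpNorm_two_sq,
    lintegral_weighted hw hφ hg]
  exact lintegral_mono' (map_withDensity_le hφ hle) le_rfl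

theorem exists_isWeightedComp {w : Y → ℂ} {φ : Y → X} (hw : AEStronglyMeasurable w ν)
    (hφ : Measurable φ) (hle : ∀ E, MeasurableSet E → ∫⁻ y in φ ⁻¹' E, ‖w y‖ₑ ^ 2 ∂ν ≤ μ E) :
    ∃ T : Lp ℂ 2 μ →L[ℂ] Lp ℂ 2 ν, IsWeightedComp T w φ := by
  have hmem : ∀ ξ : Lp ℂ 2 μ, MemLp (fun y => w y * ξ (φ y)) 2 ν := fun ξ =>
    ⟨hw.mul ((Lp.stronglyMeasurable ξ).comp_measurable hφ).aestronglyMeasurable,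
      (eLpNorm_weighted_le hw hφ hle (Lp.stronglyMeasurable ξ)).trans_lt (Lp.eLpNorm_lt_top ξ)⟩
  have key : ∀ {ξ : Lp ℂ 2 μ} {g : X → ℂ}, ξ =ᵐ[μ] g →
      (hmem ξ).toLp _ =ᵐ[ν] fun y => w y * g (φ y) := by
    intro ξ g h
    filter_upwards [(hmem ξ).coeFn_toLp, ae_weight_of_ae hw hφ hle h] with y h1 h2
    rw [h1]
    by_cases h0 : w y = 0
    · simp [h0]
    · rw [h2 h0]
  refine ⟨LinearMap.mkContinuous
    { toFun := fun ξ => (hmem ξ).toLp _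
      map_add' := fun ξ η => Lp.ext ?_
      map_smul' := fun c ξ => Lp.ext ?_ } 1 fun ξ => ?_, fun ξ => (hmem ξ).coeFn_toLp⟩
  · filter_upwards [key (Lp.coeFn_add ξ η), Lp.coeFn_add ((hmem ξ).toLp _) ((hmem η).toLp _),
      (hmem ξ).coeFn_toLp, (hmem η).coeFn_toLp] with y h1 h2 h3 h4
    rw [h1, h2, Pi.add_apply, Pi.add_apply, h3, h4, mul_add]
  · filter_upwards [key (Lp.coeFn_smul c ξ), Lp.coeFn_smul c ((hmem ξ).toLp _),
      (hmem ξ).coeFn_toLp] with y h1 h2 h3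
    rw [h1, RingHom.id_apply, h2, Pi.smul_apply, Pi.smul_apply, h3, smul_eq_mul, smul_eq_mul]
    ring
  · rw [one_mul]
    refine (Lp.norm_toLp _ (hmem ξ)).trans_le ?_
    rw [Lp.norm_def]
    exact ENNReal.toReal_mono (Lp.eLpNorm_ne_top ξ)
      (eLpNorm_weighted_le hw hφ hle (Lp.stronglyMeasurable ξ))

theorem norm_eq_of_eLpNorm_sq_eq {ξ : Lp ℂ 2 μ} {η : Lp ℂ 2 ν}
    (h : eLpNorm ξ 2 μ ^ 2 = eLpNorm η 2 ν ^ 2) : ‖ξ‖ = ‖η‖ := by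
  rw [Lp.norm_def, Lp.norm_def, ENNReal.eq_of_sq_eq_sq h]

theorem IsWeightedComp.apply_ae_eq {T : Lp ℂ 2 μ →L[ℂ] Lp ℂ 2 ν} {w : Y → ℂ} {φ : Y → X}
    (hT : IsWeightedComp T w φ) (hw : AEStronglyMeasurable w ν) (hφ : Measurable φ)
    (hle : ∀ E, MeasurableSet E → ∫⁻ y in φ ⁻¹' E, ‖w y‖ₑ ^ 2 ∂ν ≤ μ E)
    {ξ : Lp ℂ 2 μ} {g : X → ℂ} (h : ξ =ᵐ[μ] g) : T ξ =ᵐ[ν] fun y => w y * g (φ y) := by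
  filter_upwards [hT ξ, ae_weight_of_ae hw hφ hle h] with y h1 h2
  rw [h1]
  by_cases h0 : w y = 0
  · simp [h0]
  · rw [h2 h0]

/-- If the push-forward of `|w|² ν` is exactly `μ` restricted to `F`, then `T` is isometric on
functions supported in `F` and kills those supported off `F`. -/
theorem IsWeightedComp.eLpNorm_sq {T : Lp ℂ 2 μ →L[ℂ] Lp ℂ 2 ν} {w : Y → ℂ} {φ : Y → X}
    (hT : IsWeightedComp T w φ) (hw : AEStronglyMeasurable w ν) (hφ : Measurable φ)
    {F : Set X}
    (h : ∀ E, MeasurableSet E → ∫⁻ y in φ ⁻¹' E, ‖w y‖ₑ ^ 2 ∂ν = μ (E ∩ F)) (ξ : Lp ℂ 2 μ) :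
    eLpNorm (T ξ) 2 ν ^ 2 = ∫⁻ x in F, ‖ξ x‖ₑ ^ 2 ∂μ := by
  have e : (ν.withDensity fun y => ‖w y‖ₑ ^ 2).map φ = μ.restrict F := by
    ext E hE
    rw [Measure.map_apply hφ hE, withDensity_apply _ (hφ hE), h E hE, Measure.restrict_apply hE]
  rw [eLpNorm_congr_ae (hT ξ), eLpNorm_two_sq, lintegral_weighted hw hφ (Lp.stronglyMeasurable ξ), e]

/-- `T` is multiplication by the indicator function of `E`. -/
def IsIndicatorMul (T : Lp ℂ 2 μ →L[ℂ] Lp ℂ 2 μ) (E : Set X) : Prop :=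
  ∀ ξ : Lp ℂ 2 μ, (T ξ : X → ℂ) =ᵐ[μ] E.indicator ξ

theorem IsIndicatorMul.ext {S T : Lp ℂ 2 μ →L[ℂ] Lp ℂ 2 μ} {E : Set X}
    (hS : IsIndicatorMul S E) (hT : IsIndicatorMul T E) : S = T :=
  ContinuousLinearMap.ext fun ξ => Lp.ext ((hS ξ).trans (hT ξ).symm)

theorem exists_isIndicatorMul (μ : Measure X) {E : Set X} (hE : MeasurableSet E) :
    ∃ T : Lp ℂ 2 μ →L[ℂ] Lp ℂ 2 μ, IsIndicatorMul T E := by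
  obtain ⟨T, hT⟩ := exists_isWeightedComp (μ := μ) (ν := μ) (w := E.indicator 1) (φ := id)
    (stronglyMeasurable_one.indicator hE).aestronglyMeasurable measurable_id (fun F hF => by
      calc ∫⁻ y in id ⁻¹' F, ‖E.indicator (1 : X → ℂ) y‖ₑ ^ 2 ∂μ ≤ ∫⁻ y in F, 1 ∂μ := by
            refine lintegral_mono fun y => ?_
            by_cases hy : y ∈ E <;> simp [hy]
        _ = μ F := by simp)
  refine ⟨T, fun ξ => (hT ξ).trans (.of_forall fun x => ?_)⟩
  by_cases hx : x ∈ E <;> simp [hx]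

theorem IsIndicatorMul.mul {S T : Lp ℂ 2 μ →L[ℂ] Lp ℂ 2 μ} {E F : Set X}
    (hS : IsIndicatorMul S E) (hT : IsIndicatorMul T F) : IsIndicatorMul (S * T) (E ∩ F) := by
  intro ξ
  filter_upwards [hS (T ξ), hT ξ] with x h1 h2
  rw [mul_apply_eq_comp, h1]
  by_cases hx : x ∈ E <;> by_cases hy : x ∈ F <;> simp [hx, hy, h2]

theorem IsIndicatorMul.isStarProjection {T : Lp ℂ 2 μ →L[ℂ] Lp ℂ 2 μ} {E : Set X}
    (hT : IsIndicatorMul T E) : IsStarProjection T := by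
  refine ⟨IsIndicatorMul.ext (E := E) (by simpa using hT.mul hT) hT, ?_⟩
  rw [ContinuousLinearMap.isSelfAdjoint_iff_isSymmetric]
  intro ξ η
  simp only [ContinuousLinearMap.coe_coe, L2.inner_def]
  refine integral_congr_ae ?_
  filter_upwards [hT ξ, hT η] with x h1 h2
  rw [h1, h2]
  by_cases hx : x ∈ E <;> simp [hx]

theorem IsIndicatorMul.eLpNorm_sq {T : Lp ℂ 2 μ →L[ℂ] Lp ℂ 2 μ} {E : Set X}
    (hT : IsIndicatorMul T E) (hE : MeasurableSet E) (ξ : Lp ℂ 2 μ) :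
    eLpNorm (T ξ) 2 μ ^ 2 = ∫⁻ x in E, ‖ξ x‖ₑ ^ 2 ∂μ := by
  rw [eLpNorm_congr_ae (hT ξ), eLpNorm_two_sq, ← lintegral_indicator hE]
  refine lintegral_congr fun x => ?_
  by_cases hx : x ∈ E <;> simp [hx]

end WeightedComp

/-! ### Initial and range projections of partial isometries -/

section Hilbert

variable {H H' : Type*} [NormedAddCommGroup H] [InnerProductSpace ℂ H] [CompleteSpace H]
  [NormedAddCommGroup H'] [InnerProductSpace ℂ H'] [CompleteSpace H']

/-- On a complex Hilbert space an operator is determined by its quadratic form, and here `⟨T*Tξ, ξ⟩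
= ‖Tξ‖² = ‖Pξ‖² = ⟨Pξ, ξ⟩`. -/
theorem adjoint_comp_self_eq_of_norm_eq (T : H →L[ℂ] H') {P : H →L[ℂ] H} (hP : IsStarProjection P)
    (h : ∀ ξ, ‖T ξ‖ = ‖P ξ‖) : (ContinuousLinearMap.adjoint T).comp T = P := by
  have key : ((ContinuousLinearMap.adjoint T).comp T : H →ₗ[ℂ] H) = (P : H →ₗ[ℂ] H) := by
    refine (ext_inner_map _ _).1 fun ξ => ?_
    have h1 : inner ℂ (P ξ) ξ = inner ℂ (P ξ) (P ξ) := by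
      conv_lhs => rw [← hP.isIdempotentElem.eq]
      exact (ContinuousLinearMap.isSelfAdjoint_iff_isSymmetric.1 hP.isSelfAdjoint) (P ξ) ξ
    change inner ℂ (ContinuousLinearMap.adjoint T (T ξ)) ξ = inner ℂ (P ξ) ξ
    rw [ContinuousLinearMap.adjoint_inner_left, h1, inner_self_eq_norm_sq_to_K,
      inner_self_eq_norm_sq_to_K, h]
  exact ContinuousLinearMap.ext fun ξ => LinearMap.congr_fun key ξ

/-- The vector `Qη - SS*Qη` lies in the range of `Q` and is killed by `S*`, so `hinj` gives `SS*Q =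
Q`. Taking adjoints in `Q SS* = SS*` finishes the proof. -/
theorem mul_star_self_eq {S P Q : H →L[ℂ] H} (hS : star S * S = P) (hP : P * star S = star S)
    (hQ : IsStarProjection Q) (hQS : Q * S = S)
    (hinj : ∀ ζ, Q ζ = ζ → star S ζ = 0 → ζ = 0) : S * star S = Q := by
  have h1 : S * star S * Q = Q := by
    refine ContinuousLinearMap.ext fun η => ?_
    have h2 := hinj (Q η - (S * star S * Q) η) ?_ ?_
    · exact (sub_eq_zero.1 h2).symm
    · have e : Q * Q - Q * (S * star S * Q) = Q - S * star S * Q := by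
        rw [hQ.isIdempotentElem.eq, ← mul_assoc, ← mul_assoc, hQS]
      simpa using DFunLike.congr_fun e η
    · have e : star S * Q - star S * (S * star S * Q) = 0 := by
        rw [← mul_assoc, ← mul_assoc, hS, hP, sub_self]
      simpa using DFunLike.congr_fun e η
  have h2 : Q * (S * star S) = S * star S := by rw [← mul_assoc, hQS]
  have h3 := congrArg star h2
  rw [star_mul, star_mul, star_star, hQ.isSelfAdjoint.star_eq, h1] at h3
  exact h3.symm

end Hilbert

/-! ### Prefixing, shifts and cylinders on the infinite path space -/

namespace InfinitePath

open KGraph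

variable {k : ℕ} {Λ : Type u} [KGraph k Λ]

theorem mem_cylinder_iff {a : Λ} {x : InfinitePath k Λ} :
    x ∈ cylinder a ↔ x.seg 0 (deg a) zero_le = a := Iff.rfl

theorem seg_congr (x : InfinitePath k Λ) {p q p' q' : Fin k → ℕ} (h : p ≤ q) (hp : p = p')
    (hq : q = q') : x.seg p q h = x.seg p' q' (hp ▸ hq ▸ h) := by
  subst hp hq; rfl

theorem mem_cylinder_iff_of_deg {a : Λ} {n : Fin k → ℕ} (h : deg a = n) {x : InfinitePath k Λ} :
    x ∈ cylinder a ↔ x.seg 0 n zero_le = a := by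
  subst h; rfl

theorem deg_seg_zero (x : InfinitePath k Λ) (n : Fin k → ℕ) : deg (x.seg 0 n zero_le) = n := by
  rw [x.deg_seg, tsub_zero]

theorem mem_cylinder_seg (x : InfinitePath k Λ) (n : Fin k → ℕ) :
    x ∈ cylinder (x.seg 0 n zero_le) :=
  (mem_cylinder_iff_of_deg (x.deg_seg_zero n)).2 rfl

theorem take_drop_seg (x : InfinitePath k Λ) {p q : Fin k → ℕ} (h : p ≤ q) :
    take (x.seg 0 q zero_le) p = x.seg 0 p zero_le ∧ drop (x.seg 0 q zero_le) p = x.seg p q h := by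
  have := take_drop_comp (x.seg 0 p zero_le) (x.seg p q h) (by rw [x.s_seg, x.r_seg])
  rwa [x.comp_seg, x.deg_seg_zero] at this

theorem ext_of_initial {x y : InfinitePath k Λ}
    (h : ∀ n, x.seg 0 n zero_le = y.seg 0 n zero_le) : x = y := by
  ext p q hpq
  rw [← (x.take_drop_seg hpq).2, ← (y.take_drop_seg hpq).2, h]

theorem shift_mem_cylinder {a : Λ} {x : InfinitePath k Λ} (hx : x ∈ cylinder a) :
    shift (deg a) x ∈ cylinder (s a) := by
  have h0 : deg (s a) = 0 := by rw [← r_s, deg_id]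
  rw [mem_cylinder_iff_of_deg h0]
  change x.seg (0 + deg a) (0 + deg a) _ = _
  rw [x.seg_congr _ (zero_add _) (zero_add _), ← x.s_seg 0 (deg a) zero_le, mem_cylinder_iff.1 hx]

theorem prepend_shift {a : Λ} {x : InfinitePath k Λ} (hx : x ∈ cylinder a) :
    prepend a ⟨shift (deg a) x, shift_mem_cylinder hx⟩ = x := by
  refine ext_of_initial fun q => ?_
  change drop (take (comp a (x.seg (0 + deg a) (q + deg a) _)) q) 0 = _
  rw [x.seg_congr _ (zero_add (deg a)) rfl]
  have e : comp a (x.seg (deg a) (q + deg a) le_add_self) = x.seg 0 (q + deg a) zero_le := by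
    conv_lhs => rw [← mem_cylinder_iff.1 hx]
    rw [x.seg_congr (deg_seg_zero x (deg a) ▸ le_add_self) (deg_seg_zero x (deg a))
      (by rw [deg_seg_zero x (deg a)])]
    exact x.comp_seg _ _ _ _ _
  rw [e, (x.take_drop_seg le_self_add).1, (x.take_drop_seg zero_le).2]

theorem range_prepend (a : Λ) : Set.range (prepend (k := k) a) = cylinder a :=
  Set.Subset.antisymm (by rintro _ ⟨x, rfl⟩; exact prepend_mem a x)
    fun _ hx => ⟨_, prepend_shift hx⟩

theorem shift_zero (x : InfinitePath k Λ) : shift 0 x = x := by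
  refine InfinitePath.ext ?_
  funext p q h
  exact x.seg_congr _ (add_zero p) (add_zero q)

theorem shift_shift (m n : Fin k → ℕ) (x : InfinitePath k Λ) :
    shift n (shift m x) = shift (m + n) x := by
  refine InfinitePath.ext ?_
  funext p q h
  exact x.seg_congr _ (by abel) (by abel)

theorem isOpen_cylinder (a : Λ) : IsOpen (cylinder (k := k) a) :=
  TopologicalSpace.isOpen_generateFrom_of_mem ⟨a, rfl⟩

theorem measurableSet_cylinder (a : Λ) : MeasurableSet (cylinder (k := k) a) :=
  (isOpen_cylinder a).measurableSet

/-- On `Z(a)` the shift by `d(a)` is inverted by prefixing `a`. Hence every set agrees on `Z(a)`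
with a shift preimage, and identities for functions vanishing off `Z(a)` need only be tested on
shift preimages. -/
theorem image_prepend_preimage (a : Λ) (E : Set (InfinitePath k Λ)) :
    shift (deg a) ⁻¹' (Subtype.val '' (prepend (k := k) a ⁻¹' E)) ∩ cylinder a =
      E ∩ cylinder a := by
  ext x
  refine and_congr_left fun hx => ⟨?_, fun hE => ?_⟩
  · rintro ⟨y, hy, hyx⟩
    have : y = ⟨shift (deg a) x, shift_mem_cylinder hx⟩ := Subtype.ext hyx
    rwa [this, Set.mem_preimage, prepend_shift hx] at hy
  · exact ⟨⟨shift (deg a) x, shift_mem_cylinder hx⟩, by rwa [Set.mem_preimage, prepend_shift hx], rfl⟩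

theorem indicator_image_prepend_preimage {M : Type*} [Zero M] (a : Λ)
    (E : Set (InfinitePath k Λ)) {g : InfinitePath k Λ → M} {x : InfinitePath k Λ}
    (hx : x ∉ cylinder a → g x = 0) :
    E.indicator g x =
      (shift (deg a) ⁻¹' (Subtype.val '' (prepend (k := k) a ⁻¹' E))).indicator g x := by
  by_cases hxa : x ∈ cylinder a
  · have hiff := Set.ext_iff.1 (image_prepend_preimage (k := k) a E) x
    simp only [Set.mem_inter_iff, hxa, and_true] at hiff
    by_cases hE : x ∈ E
    · rw [Set.indicator_of_mem hE, Set.indicator_of_mem (hiff.2 hE)]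
    · rw [Set.indicator_of_notMem hE, Set.indicator_of_notMem (hE ∘ hiff.1)]
  · rw [Set.indicator_apply_eq_zero.2 fun _ => hx hxa,
      Set.indicator_apply_eq_zero.2 fun _ => hx hxa]

theorem prepend_preimage_shift (a : Λ) (E : Set (InfinitePath k Λ)) :
    Subtype.val '' (prepend (k := k) a ⁻¹' (shift (deg a) ⁻¹' E)) = E ∩ cylinder (s a) := by
  ext x
  constructor
  · rintro ⟨y, hy, rfl⟩
    rw [Set.mem_preimage, Set.mem_preimage, shift_prepend] at hy
    exact ⟨hy, y.2⟩
  · rintro ⟨hE, hx⟩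
    exact ⟨⟨x, hx⟩, by rwa [Set.mem_preimage, Set.mem_preimage, shift_prepend], rfl⟩

theorem disjoint_cylinder {a b : Λ} (h : deg a = deg b) (hab : a ≠ b) :
    Disjoint (cylinder (k := k) a) (cylinder b) := by
  rw [Set.disjoint_left]
  intro x ha hb
  rw [mem_cylinder_iff_of_deg h] at ha
  exact hab (ha.symm.trans hb)

theorem cylinder_subset_of_mem_pathsFrom {v a : Λ} {n : Fin k → ℕ}
    (hv : v ∈ paths Λ (0 : Fin k → ℕ)) (ha : a ∈ pathsFrom v n) :
    cylinder (k := k) a ⊆ cylinder v := by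
  intro x hx
  rw [mem_cylinder_iff_of_deg hv, ← x.r_seg 0 (deg a) zero_le, mem_cylinder_iff.1 hx, ha.1]

theorem seg_mem_pathsFrom {v : Λ} {x : InfinitePath k Λ} (hv : v ∈ paths Λ (0 : Fin k → ℕ))
    (hx : x ∈ cylinder v) (n : Fin k → ℕ) : x.seg 0 n zero_le ∈ pathsFrom v n := by
  refine ⟨?_, x.deg_seg_zero n⟩
  rw [x.r_seg]
  exact (mem_cylinder_iff_of_deg hv).1 hx

theorem seg_eq_of_le {x y : InfinitePath k Λ} {m n : Fin k → ℕ} (h : m ≤ n)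
    (hxy : x.seg 0 n zero_le = y.seg 0 n zero_le) : x.seg 0 m zero_le = y.seg 0 m zero_le := by
  rw [← (x.take_drop_seg h).1, ← (y.take_drop_seg h).1, hxy]

/-- Cylinder sets of paths with constant degree `(n, …, n)`. -/
def diagonalCylinders (k : ℕ) (Λ : Type u) [KGraph k Λ] : Set (Set (InfinitePath k Λ)) :=
  {Z | ∃ (n : ℕ) (a : Λ), deg a = (fun _ => n) ∧ Z = cylinder a}

/-- Constant degrees are totally ordered, so two such cylinders are nested or disjoint. For
incomparable degrees the intersection of two cylinders need not be a cylinder. -/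
theorem isPiSystem_diagonalCylinders : IsPiSystem (diagonalCylinders k Λ) := by
  have key : ∀ {m n : ℕ} {a b : Λ}, m ≤ n → deg a = (fun _ => m) → deg b = (fun _ => n) →
      (cylinder (k := k) a ∩ cylinder b).Nonempty → cylinder (k := k) b ⊆ cylinder a := by
    rintro m n a b hmn ha hb ⟨x, hxa, hxb⟩ y hy
    rw [mem_cylinder_iff_of_deg ha] at hxa ⊢
    rw [mem_cylinder_iff_of_deg hb] at hxb hy
    rw [← hxa]
    exact seg_eq_of_le (fun _ => hmn) (hy.trans hxb.symm)
  rintro _ ⟨m, a, ha, rfl⟩ _ ⟨n, b, hb, rfl⟩ hne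
  rcases le_total m n with h | h
  · rw [Set.inter_eq_right.2 (key h ha hb hne)]
    exact ⟨n, b, hb, rfl⟩
  · rw [Set.inter_eq_left.2 (key h hb ha (by rwa [Set.inter_comm]))]
    exact ⟨m, a, ha, rfl⟩

/-- Countability of `Λ` makes the cylinders a countable subbasis, and each `Z(a)` is a countable
union of cylinders of degree `(N, …, N)` once `N` bounds the coordinates of `d(a)`. -/
theorem borel_eq_generateFrom_diagonalCylinders :
    borel (InfinitePath k Λ) = MeasurableSpace.generateFrom (diagonalCylinders k Λ) := by
  have hc : Countable Λ := KGraph.countable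
  have : SecondCountableTopology (InfinitePath k Λ) := ⟨_, Set.countable_range _, rfl⟩
  rw [borel_eq_generateFrom_of_subbasis (s := Set.range (cylinder (k := k) (Λ := Λ))) rfl]
  refine le_antisymm (MeasurableSpace.generateFrom_le ?_) (MeasurableSpace.generateFrom_mono ?_)
  · rintro _ ⟨a, rfl⟩
    obtain ⟨N, hN⟩ : ∃ N : ℕ, ∀ i, deg a i ≤ N :=
      ⟨Finset.univ.sup (deg a), fun i => Finset.le_sup (Finset.mem_univ i)⟩
    have : cylinder (k := k) a = ⋃ b ∈ {b : Λ | deg b = (fun _ => N) ∧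
        cylinder (k := k) b ⊆ cylinder a}, cylinder b := by
      refine Set.Subset.antisymm (fun x hx => ?_) (Set.iUnion₂_subset fun b hb => hb.2)
      refine Set.mem_biUnion (x := x.seg 0 (fun _ => N) zero_le)
        ⟨x.deg_seg_zero _, fun y hy => ?_⟩ (mem_cylinder_seg _ _)
      rw [mem_cylinder_iff_of_deg (x.deg_seg_zero _)] at hy
      exact (seg_eq_of_le hN hy).trans hx
    rw [this]
    exact MeasurableSet.biUnion (Set.to_countable _) fun b hb =>
      MeasurableSpace.measurableSet_generateFrom ⟨N, b, hb.1, rfl⟩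
  · rintro _ ⟨n, a, -, rfl⟩
    exact ⟨a, rfl⟩

end InfinitePath

/-! ## The operators of a projective system on the infinite path space -/

/-- The standard maps and the functions `f` form a projective system on `(Λ^∞, μ)`. -/
abbrev IsPathSystem {k : ℕ} {Λ : Type u} [KGraph k Λ] (μ : Measure (InfinitePath k Λ))
    (f : Λ → InfinitePath k Λ → ℂ) : Prop :=
  IsProjectiveSystem μ (fun a : Λ => InfinitePath.cylinder (KGraph.s a))
    InfinitePath.prepend InfinitePath.shift f

namespace IsPathSystem

open KGraph InfinitePath

variable {k : ℕ} {Λ : Type u} [KGraph k Λ] {μ : Measure (InfinitePath k Λ)}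
  {f : Λ → InfinitePath k Λ → ℂ}

theorem measurable_shift (h : IsPathSystem μ f) (n : Fin k → ℕ) :
    Measurable (shift (Λ := Λ) n) :=
  (h.semibranching n).measurable_coding

theorem measurableSet_image (h : IsPathSystem μ f) (a : Λ) {E : Set (InfinitePath k Λ)}
    (hE : MeasurableSet E) : MeasurableSet (Subtype.val '' (prepend (k := k) a ⁻¹' E)) :=
  (measurableSet_cylinder (s a)).subtype_image
    ((h.semibranching (deg a)).measurable_map ⟨a, rfl⟩ hE)

theorem aestronglyMeasurable (h : IsPathSystem μ f) (a : Λ) : AEStronglyMeasurable (f a) μ :=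
  (h.memLp a).aestronglyMeasurable

/-- The Radon–Nikodym identity is applied to `σ^{-d(a)}(E)`, which prefixing by `a` pulls back to `E
∩ Z(s(a))`. In this form it computes the push-forward of `|f_a|² μ`. -/
theorem setLIntegral_shift_preimage (h : IsPathSystem μ f) (a : Λ) (E : Set (InfinitePath k Λ))
    (hE : MeasurableSet E) :
    ∫⁻ x in shift (deg a) ⁻¹' E, ‖f a x‖ₑ ^ 2 ∂μ = μ (E ∩ cylinder (s a)) := by
  rw [← prepend_preimage_shift]
  exact (h.rnDeriv_eq a _ (h.measurable_shift _ hE)).symm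

theorem setLIntegral_shift_preimage_le (h : IsPathSystem μ f) (a : Λ)
    (E : Set (InfinitePath k Λ)) (hE : MeasurableSet E) :
    ∫⁻ x in shift (deg a) ⁻¹' E, ‖f a x‖ₑ ^ 2 ∂μ ≤ μ E :=
  (h.setLIntegral_shift_preimage a E hE).trans_le (measure_mono Set.inter_subset_left)

theorem ae_eq_zero_of_notMem (h : IsPathSystem μ f) (a : Λ) :
    ∀ᵐ x ∂μ, x ∉ cylinder a → f a x = 0 := by
  have h0 := h.rnDeriv_eq a (cylinder a)ᶜ (measurableSet_cylinder a).compl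
  have h1 : prepend (k := k) a ⁻¹' (cylinder a)ᶜ = ∅ := by
    ext x
    simp [prepend_mem]
  rw [h1, Set.image_empty, measure_empty, eq_comm,
    lintegral_eq_zero_iff' (((h.aestronglyMeasurable a).enorm.pow_const 2).restrict)] at h0
  filter_upwards [(ae_restrict_iff' (measurableSet_cylinder a).compl).1 h0] with x hx hxa
  simpa using hx hxa

theorem ae_ne_zero (h : IsPathSystem μ f) (a : Λ) : ∀ᵐ x ∂μ, x ∈ cylinder a → f a x ≠ 0 := by
  have := h.ne_zero a
  rwa [range_prepend] at this

theorem s_eq_self {v : Λ} (hv : v ∈ paths Λ (0 : Fin k → ℕ)) : s v = v := by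
  have h : v = r v := eq_r_of_deg_zero v hv
  rw [h, s_r]

theorem s_mem_paths (a : Λ) : s a ∈ paths Λ (0 : Fin k → ℕ) := by
  change deg (s a) = 0
  rw [← r_s, deg_id]

theorem setLIntegral_vertex (h : IsPathSystem μ f) {v : Λ} (hv : v ∈ paths Λ (0 : Fin k → ℕ))
    {E : Set (InfinitePath k Λ)} (hE : MeasurableSet E) :
    ∫⁻ x in E, ‖f v x‖ₑ ^ 2 ∂μ = μ (E ∩ cylinder v) := by
  have := h.setLIntegral_shift_preimage v E hE
  rw [s_eq_self hv] at this
  rw [← this]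
  congr 2
  ext x
  rw [Set.mem_preimage, show deg v = 0 from hv, shift_zero]

/-- The finitely many vertex cylinders cover the space, and `μ(Z(v)) = ‖f_v‖₂²` is finite because
`f_v` is in `L²`. -/
theorem isFiniteMeasure (h : IsPathSystem μ f) (hfin : IsFinite Λ) : IsFiniteMeasure μ := by
  have hcov : (Set.univ : Set (InfinitePath k Λ)) ⊆
      ⋃ v ∈ paths Λ (0 : Fin k → ℕ), cylinder v := fun x _ =>
    Set.mem_biUnion (x := x.seg 0 0 zero_le) (x.deg_seg_zero 0) (mem_cylinder_seg x 0)
  refine ⟨(measure_mono hcov).trans_lt (measure_biUnion_lt_top (hfin 0) fun v hv => ?_)⟩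
  have h1 := h.setLIntegral_vertex hv MeasurableSet.univ
  rw [Set.univ_inter, Measure.restrict_univ, ← eLpNorm_two_sq] at h1
  rw [← h1]
  exact ENNReal.pow_lt_top (h.memLp v).2

theorem vertex_ae_eq (h : IsPathSystem μ f) (hfin : IsFinite Λ)
    (hf : ∀ a, ∀ᵐ x ∂μ, 0 ≤ f a x) {v : Λ} (hv : v ∈ paths Λ (0 : Fin k → ℕ)) :
    f v =ᵐ[μ] (cylinder v).indicator 1 := by
  have := h.isFiniteMeasure hfin
  have h1 : (fun x => ‖f v x‖ₑ ^ 2) =ᵐ[μ] (cylinder v).indicator 1 := by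
    refine ae_eq_of_forall_setLIntegral_eq_of_sigmaFinite₀
      ((h.aestronglyMeasurable v).enorm.pow_const 2)
      (measurable_one.indicator (measurableSet_cylinder v)).aemeasurable fun E hE _ => ?_
    rw [h.setLIntegral_vertex hv hE, lintegral_indicator_one (measurableSet_cylinder v),
      Measure.restrict_apply (measurableSet_cylinder v), Set.inter_comm]
  filter_upwards [h1, hf v] with x hx h0
  by_cases hxv : x ∈ cylinder v
  · rw [Set.indicator_of_mem hxv] at hx ⊢
    exact eq_of_nonneg_of_enorm_sq_eq h0 zero_le_one (by simpa using hx)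
  · rw [Set.indicator_of_notMem hxv] at hx ⊢
    simpa using hx

theorem exists_operators (h : IsPathSystem μ f) :
    ∃ S : Λ → Lp ℂ 2 μ →L[ℂ] Lp ℂ 2 μ, ∀ a, IsWeightedComp (S a) (f a) (shift (deg a)) :=
  Classical.skolem.1 fun a => exists_isWeightedComp (h.aestronglyMeasurable a)
    (h.measurable_shift _) (h.setLIntegral_shift_preimage_le a)

variable {S : Λ → Lp ℂ 2 μ →L[ℂ] Lp ℂ 2 μ}

theorem mul_eq (h : IsPathSystem μ f) (hS : ∀ a, IsWeightedComp (S a) (f a) (shift (deg a)))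
    {a b : Λ} (hab : s a = r b) : S a * S b = S (comp a b) := by
  refine ContinuousLinearMap.ext fun ξ => Lp.ext ?_
  filter_upwards [(hS a).apply_ae_eq (h.aestronglyMeasurable a) (h.measurable_shift _)
    (h.setLIntegral_shift_preimage_le a) (hS b ξ), hS (comp a b) ξ, h.cocycle a b hab]
    with x h1 h2 h3
  rw [mul_apply_eq_comp, h1, h2, ← h3, shift_shift, deg_comp a b hab, mul_assoc]

theorem isIndicatorMul_vertex (h : IsPathSystem μ f) (hfin : IsFinite Λ)
    (hf : ∀ a, ∀ᵐ x ∂μ, 0 ≤ f a x) (hS : ∀ a, IsWeightedComp (S a) (f a) (shift (deg a)))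
    {v : Λ} (hv : v ∈ paths Λ (0 : Fin k → ℕ)) : IsIndicatorMul (S v) (cylinder v) := by
  intro ξ
  filter_upwards [hS v ξ, h.vertex_ae_eq hfin hf hv] with x h1 h2
  rw [h1, h2, show deg v = 0 from hv, shift_zero]
  by_cases hx : x ∈ cylinder v <;> simp [hx]

theorem star_mul_self_eq (h : IsPathSystem μ f) (hfin : IsFinite Λ)
    (hf : ∀ a, ∀ᵐ x ∂μ, 0 ≤ f a x) (hS : ∀ a, IsWeightedComp (S a) (f a) (shift (deg a)))
    (a : Λ) : star (S a) * S a = S (s a) := by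
  have hv := h.isIndicatorMul_vertex hfin hf hS (s_mem_paths a)
  refine adjoint_comp_self_eq_of_norm_eq (S a) hv.isStarProjection fun ξ =>
    norm_eq_of_eLpNorm_sq_eq ?_
  rw [hv.eLpNorm_sq (measurableSet_cylinder _), (hS a).eLpNorm_sq (h.aestronglyMeasurable a)
    (h.measurable_shift _) (h.setLIntegral_shift_preimage a)]

theorem indicator_mul_eq (h : IsPathSystem μ f)
    (hS : ∀ a, IsWeightedComp (S a) (f a) (shift (deg a)))
    {a : Λ} {Q : Lp ℂ 2 μ →L[ℂ] Lp ℂ 2 μ} (hQ : IsIndicatorMul Q (cylinder a)) :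
    Q * S a = S a := by
  refine ContinuousLinearMap.ext fun ξ => Lp.ext ?_
  filter_upwards [hQ (S a ξ), hS a ξ, h.ae_eq_zero_of_notMem a] with x h1 h2 h3
  rw [mul_apply_eq_comp, h1]
  by_cases hx : x ∈ cylinder a
  · rw [Set.indicator_of_mem hx]
  · rw [Set.indicator_of_notMem hx, h2, h3 hx, zero_mul]

/-- Pairing `ζ` with `S_a 1_F` shows that `star (f_a) ζ` has zero integral over every shift
preimage. It vanishes off `Z(a)`, so these sets suffice to make it zero, and `f_a ≠ 0` on `Z(a)`. -/
theorem eq_zero_of_star_apply_eq_zero (h : IsPathSystem μ f) (hfin : IsFinite Λ)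
    (hS : ∀ a, IsWeightedComp (S a) (f a) (shift (deg a))) {a : Λ} {ζ : Lp ℂ 2 μ}
    (hζ : (ζ : InfinitePath k Λ → ℂ) =ᵐ[μ] (cylinder a).indicator ζ) (h0 : star (S a) ζ = 0) :
    ζ = 0 := by
  have := h.isFiniteMeasure hfin
  have hG : Integrable (fun x => star (f a x) * ζ x) μ :=
    (h.memLp a).star.integrable_mul (Lp.memLp ζ)
  have hGa : ∀ᵐ x ∂μ, x ∉ cylinder a → star (f a x) * ζ x = 0 := by
    filter_upwards [h.ae_eq_zero_of_notMem a] with x hx hxa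
    rw [hx hxa, star_zero, zero_mul]
  have hshift : ∀ F : Set (InfinitePath k Λ), MeasurableSet F →
      ∫ x in shift (deg a) ⁻¹' F, star (f a x) * ζ x ∂μ = 0 := by
    intro F hF
    have h1 : inner ℂ (S a (indicatorConstLp 2 hF (measure_ne_top μ F) (1 : ℂ))) ζ = 0 := by
      rw [← ContinuousLinearMap.adjoint_inner_right]
      change inner ℂ _ (star (S a) ζ) = 0
      rw [h0, inner_zero_right]
    rw [← integral_indicator (h.measurable_shift _ hF), ← h1, L2.inner_def]
    refine integral_congr_ae ?_
    filter_upwards [(hS a).apply_ae_eq (h.aestronglyMeasurable a) (h.measurable_shift _)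
      (h.setLIntegral_shift_preimage_le a) (indicatorConstLp_coeFn (p := 2) (hs := hF)
        (hμs := measure_ne_top μ F) (c := (1 : ℂ)))] with x hx
    rw [hx]
    by_cases hxF : shift (deg a) x ∈ F
    · rw [Set.indicator_of_mem (show x ∈ shift (deg a) ⁻¹' F from hxF), Set.indicator_of_mem hxF]
      simp [mul_comm]
    · rw [Set.indicator_of_notMem (show x ∉ shift (deg a) ⁻¹' F from hxF),
        Set.indicator_of_notMem hxF]
      simp
  have hGz : (fun x => star (f a x) * ζ x) =ᵐ[μ] 0 := by
    refine hG.ae_eq_zero_of_forall_setIntegral_eq_zero fun E hE _ => ?_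
    have hF := h.measurableSet_image a hE
    rw [← hshift _ hF, ← integral_indicator hE, ← integral_indicator (h.measurable_shift _ hF)]
    refine integral_congr_ae ?_
    filter_upwards [hGa] with x hx
    exact indicator_image_prepend_preimage a E hx
  refine Lp.ext ?_
  filter_upwards [hGz, hζ, h.ae_ne_zero a, Lp.coeFn_zero ℂ 2 μ] with x h1 h2 h3 h4
  rw [h4]
  by_cases hxa : x ∈ cylinder a
  · exact (mul_eq_zero.1 h1).resolve_left (star_ne_zero.2 (h3 hxa))
  · rw [h2, Set.indicator_of_notMem hxa]; rfl

theorem partialIsometry_eq (h : IsPathSystem μ f) (hfin : IsFinite Λ)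
    (hf : ∀ a, ∀ᵐ x ∂μ, 0 ≤ f a x) (hS : ∀ a, IsWeightedComp (S a) (f a) (shift (deg a)))
    (a : Λ) : S a * star (S a) * S a = S a := by
  rw [mul_assoc, h.star_mul_self_eq hfin hf hS, h.mul_eq hS (r_s a).symm, comp_id]

/-- The range projection does not depend on the weights. Through it the representation sees the
measure, and it lets operators between the two `L²` spaces be compared on cylinders. -/
theorem isIndicatorMul_mul_star (h : IsPathSystem μ f) (hfin : IsFinite Λ)
    (hf : ∀ a, ∀ᵐ x ∂μ, 0 ≤ f a x) (hS : ∀ a, IsWeightedComp (S a) (f a) (shift (deg a)))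
    (a : Λ) : IsIndicatorMul (S a * star (S a)) (cylinder a) := by
  obtain ⟨Q, hQ⟩ := exists_isIndicatorMul μ (measurableSet_cylinder (k := k) a)
  have hP := h.star_mul_self_eq hfin hf hS a
  rw [mul_star_self_eq hP ?_ hQ.isStarProjection (h.indicator_mul_eq hS hQ) fun ζ h1 h2 =>
    h.eq_zero_of_star_apply_eq_zero hfin hS ?_ h2]
  · exact hQ
  · have := congrArg star (h.partialIsometry_eq hfin hf hS a)
    rwa [star_mul, star_mul, star_star, ← mul_assoc, hP] at this
  · have := hQ ζ
    rwa [h1] at this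

theorem isCKFamily (h : IsPathSystem μ f) (hfin : IsFinite Λ)
    (hf : ∀ a, ∀ᵐ x ∂μ, 0 ≤ f a x) (hS : ∀ a, IsWeightedComp (S a) (f a) (shift (deg a))) :
    IsCKFamily S where
  partialIsometry := h.partialIsometry_eq hfin hf hS
  vertex_proj v hv := (h.isIndicatorMul_vertex hfin hf hS hv).isStarProjection
  vertex_orth v hv w hw hvw := by
    have hmul := (h.isIndicatorMul_vertex hfin hf hS hv).mul
      (h.isIndicatorMul_vertex hfin hf hS hw)
    rw [(disjoint_cylinder (hv.trans hw.symm) hvw).inter_eq] at hmul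
    refine hmul.ext fun ξ => ?_
    rw [Set.indicator_empty]
    exact Lp.coeFn_zero ℂ 2 μ
  mul a b hab := h.mul_eq hS hab
  star_mul_self := h.star_mul_self_eq hfin hf hS
  sum v hv n := by
    have hfin' : (pathsFrom v n).Finite := (hfin n).subset fun a ha => ha.2
    rw [finsum_mem_eq_finite_toFinset_sum _ hfin']
    refine (h.isIndicatorMul_vertex hfin hf hS hv).ext fun ξ => ?_
    have hc : Countable Λ := KGraph.countable
    have hall : ∀ᵐ x ∂μ, ∀ a, (S a * star (S a)) ξ x = (cylinder a).indicator ξ x :=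
      ae_all_iff.2 fun a => h.isIndicatorMul_mul_star hfin hf hS a ξ
    rw [sum_apply]
    filter_upwards [hall, Lp.coeFn_finsetSum hfin'.toFinset (fun a => (S a * star (S a)) ξ)]
      with x h1 h2
    rw [h2, Finset.sum_apply, Finset.sum_congr rfl fun a _ => h1 a]
    by_cases hx : x ∈ cylinder v
    -- For `x ∈ Z(v)` exactly one arrow of `vΛ^n` contributes, the initial segment `x(0,n)`.
    · rw [Set.indicator_of_mem hx, Finset.sum_eq_single (x.seg 0 n zero_le),
        Set.indicator_of_mem (mem_cylinder_seg x n)]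
      · intro a ha hax
        refine Set.indicator_of_notMem (fun hxa => hax ?_) _
        exact ((mem_cylinder_iff_of_deg ((Set.Finite.mem_toFinset hfin').1 ha).2).1 hxa).symm
      · exact fun hn => (hn ((Set.Finite.mem_toFinset hfin').2 (seg_mem_pathsFrom hv hx n))).elim
    · rw [Set.indicator_of_notMem hx]
      refine Finset.sum_eq_zero fun a ha => Set.indicator_of_notMem (fun hxa => hx ?_) _
      exact cylinder_subset_of_mem_pathsFrom hv ((Set.Finite.mem_toFinset hfin').1 ha) hxa

end IsPathSystem

/-! ## Representations of `C*(Λ)` -/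

section Representations

variable {k : ℕ} {Λ : Type u} [KGraph k Λ]

theorem KGraphCStar.induction {p : KGraphCStar k Λ → Prop} (hgen : ∀ a, p (KGraphCStar.gen k a))
    (hzero : p 0) (hadd : ∀ x y, p x → p y → p (x + y)) (hsmul : ∀ (c : ℂ) x, p x → p (c • x))
    (hmul : ∀ x y, p x → p y → p (x * y)) (hstar : ∀ x, p x → p (star x))
    (hclosed : IsClosed {x | p x}) (x : KGraphCStar k Λ) : p x := by
  have hsub : ∀ y (hy : y ∈ NonUnitalStarAlgebra.adjoin ℂ (Set.range (ckTuple k (Λ := Λ)))),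
      p ⟨y, NonUnitalStarSubalgebra.le_topologicalClosure _ hy⟩ := by
    intro y hy
    induction hy using NonUnitalStarAlgebra.adjoin_induction with
    | mem y hy => obtain ⟨a, rfl⟩ := hy; exact hgen a
    | add y z _ _ h1 h2 => exact hadd _ _ h1 h2
    | zero => exact hzero
    | mul y z _ _ h1 h2 => exact hmul _ _ h1 h2
    | smul c y _ h1 => exact hsmul c _ h1
    | star y _ h1 => exact hstar _ h1
  have hx : x ∈ closure {z : KGraphCStar k Λ |
      (z : lp (fun T : CKFamily k Λ => T.alg) ∞) ∈
        NonUnitalStarAlgebra.adjoin ℂ (Set.range (ckTuple k (Λ := Λ)))} := by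
    rw [closure_subtype]
    refine closure_mono ?_ x.2
    intro y hy
    exact ⟨⟨y, NonUnitalStarSubalgebra.le_topologicalClosure _ hy⟩, hy, rfl⟩
  exact closure_minimal (fun z hz => hsub z.1 hz) hclosed hx

theorem continuous_rep {H : Type*} [NormedAddCommGroup H] [InnerProductSpace ℂ H] [CompleteSpace H]
    (π : KGraphCStar k Λ →⋆ₙₐ[ℂ] (H →L[ℂ] H)) : Continuous π :=
  AddMonoidHomClass.continuous_of_bound π 1 fun x => by
    simpa only [one_mul] using NonUnitalStarAlgHom.norm_apply_le π x

theorem rep_ext {H : Type*} [NormedAddCommGroup H] [InnerProductSpace ℂ H] [CompleteSpace H]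
    {π π' : KGraphCStar k Λ →⋆ₙₐ[ℂ] (H →L[ℂ] H)}
    (h : ∀ a, π (KGraphCStar.gen k a) = π' (KGraphCStar.gen k a)) : π = π' := by
  refine NonUnitalStarAlgHom.ext fun x => ?_
  induction x using KGraphCStar.induction with
  | hgen a => exact h a
  | hzero => rw [map_zero, map_zero]
  | hadd x y hx hy => rw [map_add, map_add, hx, hy]
  | hsmul c x hx => rw [map_smul, map_smul, hx]
  | hmul x y hx hy => rw [map_mul, map_mul, hx, hy]
  | hstar x hx => rw [map_star, map_star, hx]
  | hclosed => exact isClosed_eq (continuous_rep π) (continuous_rep π')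

theorem intertwines_of_generators {H H' : Type*} [NormedAddCommGroup H] [InnerProductSpace ℂ H]
    [CompleteSpace H] [NormedAddCommGroup H'] [InnerProductSpace ℂ H'] [CompleteSpace H']
    {π : KGraphCStar k Λ →⋆ₙₐ[ℂ] (H →L[ℂ] H)} {π' : KGraphCStar k Λ →⋆ₙₐ[ℂ] (H' →L[ℂ] H')}
    {W : H →L[ℂ] H'}
    (h : ∀ a ξ, W (π (KGraphCStar.gen k a) ξ) = π' (KGraphCStar.gen k a) (W ξ))
    (h' : ∀ a ξ, W (star (π (KGraphCStar.gen k a)) ξ) = star (π' (KGraphCStar.gen k a)) (W ξ))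
    (x : KGraphCStar k Λ) (ξ : H) : W (π x ξ) = π' x (W ξ) := by
  -- The claim is proved for `x` and `star x` together: products need nothing more, and the star
  -- case becomes a swap.
  suffices H : (∀ ξ, W (π x ξ) = π' x (W ξ)) ∧
      ∀ ξ, W (π (star x) ξ) = π' (star x) (W ξ) from H.1 ξ
  induction x using KGraphCStar.induction with
  | hgen a => exact ⟨h a, fun ξ => by rw [map_star, map_star, h']⟩
  | hzero => simp
  | hadd x y hx hy =>
    refine ⟨fun ξ => ?_, fun ξ => ?_⟩
    · rw [map_add, map_add, add_apply, add_apply, map_add, hx.1,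
        hy.1]
    · rw [star_add, map_add, map_add, add_apply, add_apply,
        map_add, hx.2, hy.2]
  | hsmul c x hx =>
    refine ⟨fun ξ => ?_, fun ξ => ?_⟩
    · rw [map_smul, map_smul, smul_apply, smul_apply, map_smul,
        hx.1]
    · rw [star_smul, map_smul, map_smul, smul_apply,
        smul_apply, map_smul, hx.2]
  | hmul x y hx hy =>
    refine ⟨fun ξ => ?_, fun ξ => ?_⟩
    · rw [map_mul, map_mul, mul_apply_eq_comp, mul_apply_eq_comp, hx.1, hy.1]
    · rw [star_mul, map_mul, map_mul, mul_apply_eq_comp, mul_apply_eq_comp, hy.2, hx.2]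
  | hstar x hx => exact ⟨hx.2, by rw [star_star]; exact hx.1⟩
  | hclosed =>
    have hcl : ∀ σ : KGraphCStar k Λ → KGraphCStar k Λ, Continuous σ →
        IsClosed {x | ∀ ξ, W (π (σ x) ξ) = π' (σ x) (W ξ)} := by
      intro σ hσ
      simp only [Set.ofPred_forall]
      refine isClosed_iInter fun ξ => isClosed_eq ?_ ?_
      · exact W.continuous.comp (((continuous_rep π).comp hσ).clm_apply continuous_const)
      · exact ((continuous_rep π').comp hσ).clm_apply continuous_const
    exact (hcl id continuous_id).inter (hcl star continuous_star)

end Representations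

/-! ### Partially isometric intertwiners and disjointness -/

section Hilbert

variable {A H H' : Type*} [NonUnitalCStarAlgebra A] [NormedAddCommGroup H] [InnerProductSpace ℂ H]
  [CompleteSpace H] [NormedAddCommGroup H'] [InnerProductSpace ℂ H'] [CompleteSpace H']

/-- Since representations preserve adjoints, `W*` intertwines in the other direction. So the fixed
spaces of `W*W` and `WW*` are invariant, and `hpi` makes `W` a unitary between them; they are
nonzero when `W` is. -/
theorem not_areDisjoint_of_intertwiner {π : A →⋆ₙₐ[ℂ] (H →L[ℂ] H)}
    {π' : A →⋆ₙₐ[ℂ] (H' →L[ℂ] H')} {W : H →L[ℂ] H'} (hW : ∀ a ξ, W (π a ξ) = π' a (W ξ))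
    (hpi : ∀ ξ, W (ContinuousLinearMap.adjoint W (W ξ)) = W ξ) (h0 : W ≠ 0) :
    ¬ AreDisjoint π π' := by
  set V := ContinuousLinearMap.adjoint W with hV
  have hVπ : ∀ a η, V (π' a η) = π a (V η) := by
    intro a η
    refine ext_inner_right ℂ fun ξ => ?_
    have e : ∀ (ξ : H) (η : H'), inner ℂ (V η) ξ = inner ℂ η (W ξ) := fun ξ η =>
      ContinuousLinearMap.adjoint_inner_left W ξ η
    have h1 : ∀ ζ, inner ℂ (π a ζ) ξ = inner ℂ ζ (π (star a) ξ) := fun ζ => by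
      rw [map_star]
      exact (ContinuousLinearMap.adjoint_inner_right (π a) ζ ξ).symm
    have h2 : ∀ ζ ω, inner ℂ (π' a ζ) ω = inner ℂ ζ (π' (star a) ω) := fun ζ ω => by
      rw [map_star]
      exact (ContinuousLinearMap.adjoint_inner_right (π' a) ζ ω).symm
    rw [e, h2, h1, e, hW]
  let K : Submodule ℂ H :=
    LinearMap.ker ((V.comp W - ContinuousLinearMap.id ℂ H : H →L[ℂ] H) : H →ₗ[ℂ] H)
  let K' : Submodule ℂ H' :=
    LinearMap.ker ((W.comp V - ContinuousLinearMap.id ℂ H' : H' →L[ℂ] H') : H' →ₗ[ℂ] H')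
  have hK : ∀ {ξ}, ξ ∈ K ↔ V (W ξ) = ξ := by
    intro ξ
    rw [LinearMap.mem_ker]
    exact sub_eq_zero
  have hK' : ∀ {η}, η ∈ K' ↔ W (V η) = η := by
    intro η
    rw [LinearMap.mem_ker]
    exact sub_eq_zero
  intro hdis
  refine hdis K K' (ContinuousLinearMap.isClosed_ker _) (ContinuousLinearMap.isClosed_ker _)
    (fun a ξ hξ => hK.2 (by rw [hW, hVπ, hK.1 hξ])) (fun a η hη => hK'.2 (by rw [hVπ, hW, hK'.1 hη]))
    (fun hbot => h0 (ContinuousLinearMap.ext fun ξ => ?_))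
    ⟨{ toFun := fun ξ => ⟨W ξ, hK'.2 (by rw [hpi])⟩
       invFun := fun η => ⟨V η, hK.2 (by rw [hK'.1 η.2])⟩
       map_add' := fun ξ η => Subtype.ext (map_add W _ _)
       map_smul' := fun c ξ => Subtype.ext (map_smul W _ _)
       left_inv := fun ξ => Subtype.ext (hK.1 ξ.2)
       right_inv := fun η => Subtype.ext (hK'.1 η.2)
       norm_map' := fun ξ => ?_ }, fun a ξ => hW a ξ⟩
  · have h1 : V (W ξ) ∈ K := hK.2 (by rw [hpi])
    rw [hbot, Submodule.mem_bot] at h1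
    rw [← hpi, h1, map_zero]; rfl
  · change ‖W ξ‖ = ‖(ξ : H)‖
    have h1 : inner ℂ (V (W ξ)) (ξ : H) = inner ℂ (W ξ) (W ξ) :=
      ContinuousLinearMap.adjoint_inner_left W _ _
    rw [hK.1 ξ.2, inner_self_eq_norm_sq_to_K, inner_self_eq_norm_sq_to_K] at h1
    have h2 : ‖(ξ : H)‖ ^ 2 = ‖W ξ‖ ^ 2 := by exact_mod_cast h1
    exact ((sq_eq_sq₀ (norm_nonneg _) (norm_nonneg _)).1 h2).symm

end Hilbert

/-! ### Existence of the representation; singular measures give disjointness -/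

namespace IsPathSystem

open KGraph InfinitePath

variable {k : ℕ} {Λ : Type u} [KGraph k Λ] {μ μ' : Measure (InfinitePath k Λ)}
  {f f' : Λ → InfinitePath k Λ → ℂ}

theorem existsUnique_rep (h : IsPathSystem μ f) (hfin : IsFinite Λ)
    (hf : ∀ a, ∀ᵐ x ∂μ, 0 ≤ f a x) : ∃! π, IsAssociatedRep μ shift f π := by
  obtain ⟨S, hS⟩ := h.exists_operators
  obtain ⟨π, hπ⟩ := KGraphCStar.exists_lift S (h.isCKFamily hfin hf hS)
  have hassoc : IsAssociatedRep μ shift f π := fun a => by rw [hπ]; exact hS a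
  refine ⟨π, hassoc, fun π' hπ' => rep_ext fun a => ?_⟩
  exact IsWeightedComp.ext (hπ' a) (hassoc a) (ae_eq_refl _)

/-- A unitary equivalence preserves the norms of `S_a S_a* ξ`, that is, the masses of cylinders
under `|ξ|² μ`. The resulting measure is absolutely continuous with respect to both `μ` and `μ'`,
hence singular to itself. -/
theorem areDisjoint_of_mutuallySingular (h : IsPathSystem μ f) (h' : IsPathSystem μ' f')
    (hfin : IsFinite Λ) (hf : ∀ a, ∀ᵐ x ∂μ, 0 ≤ f a x) (hf' : ∀ a, ∀ᵐ x ∂μ', 0 ≤ f' a x)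
    {π : KGraphCStar k Λ →⋆ₙₐ[ℂ] (Lp ℂ 2 μ →L[ℂ] Lp ℂ 2 μ)}
    {π' : KGraphCStar k Λ →⋆ₙₐ[ℂ] (Lp ℂ 2 μ' →L[ℂ] Lp ℂ 2 μ')}
    (hπ : IsAssociatedRep μ shift f π) (hπ' : IsAssociatedRep μ' shift f' π')
    (hs : μ ⟂ₘ μ') : AreDisjoint π π' := by
  rintro K K' - - hK hK' hne ⟨U, hU⟩
  refine hne ((Submodule.eq_bot_iff _).2 fun ξ hξ => ?_)
  let η : Lp ℂ 2 μ' := ((U ⟨ξ, hξ⟩ : K') : Lp ℂ 2 μ')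
  have heq : ∀ (ζ : Lp ℂ 2 μ) (hζ : ζ ∈ K),
      eLpNorm ζ 2 μ ^ 2 = eLpNorm ((U ⟨ζ, hζ⟩ : K') : Lp ℂ 2 μ') 2 μ' ^ 2 := by
    intro ζ hζ
    have h1 : ‖((U ⟨ζ, hζ⟩ : K') : Lp ℂ 2 μ')‖ = ‖ζ‖ := U.norm_map ⟨ζ, hζ⟩
    rw [Lp.norm_def, Lp.norm_def, ENNReal.toReal_eq_toReal_iff' (Lp.eLpNorm_ne_top _)
      (Lp.eLpNorm_ne_top _)] at h1
    rw [h1]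
  have hcyl : ∀ a : Λ, ∫⁻ x in cylinder a, ‖ξ x‖ₑ ^ 2 ∂μ = ∫⁻ x in cylinder a, ‖η x‖ₑ ^ 2 ∂μ' := by
    intro a
    have e1 := h.isIndicatorMul_mul_star hfin hf hπ a
    have e2 := h'.isIndicatorMul_mul_star hfin hf' hπ' a
    have hx := heq _ (hK (KGraphCStar.gen k a * star (KGraphCStar.gen k a)) ξ hξ)
    have hU' := hU (KGraphCStar.gen k a * star (KGraphCStar.gen k a)) ⟨ξ, hξ⟩
    rw [hU', map_mul, map_mul, map_star, map_star, e1.eLpNorm_sq (measurableSet_cylinder a),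
      e2.eLpNorm_sq (measurableSet_cylinder a)] at hx
    exact hx
  have huniv : ∫⁻ x, ‖ξ x‖ₑ ^ 2 ∂μ = ∫⁻ x, ‖η x‖ₑ ^ 2 ∂μ' := by
    rw [← eLpNorm_two_sq, ← eLpNorm_two_sq, heq ξ hξ]
  have : IsFiniteMeasure (μ.withDensity fun x => ‖ξ x‖ₑ ^ 2) :=
    isFiniteMeasure_withDensity (by
      rw [← eLpNorm_two_sq]
      exact ENNReal.pow_ne_top (Lp.eLpNorm_ne_top ξ))
  have hmeas : (μ.withDensity fun x => ‖ξ x‖ₑ ^ 2) = μ'.withDensity fun x => ‖η x‖ₑ ^ 2 := by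
    refine ext_of_generate_finite (diagonalCylinders k Λ) borel_eq_generateFrom_diagonalCylinders
      isPiSystem_diagonalCylinders ?_ ?_
    · rintro _ ⟨n, a, -, rfl⟩
      rw [withDensity_apply _ (measurableSet_cylinder a),
        withDensity_apply _ (measurableSet_cylinder a), hcyl]
    · rw [withDensity_apply _ .univ, withDensity_apply _ .univ, Measure.restrict_univ,
        Measure.restrict_univ, huniv]
  have hzero : (μ.withDensity fun x => ‖ξ x‖ₑ ^ 2) = 0 := by
    rw [← Measure.MutuallySingular.self_iff]
    refine (hs.mono_ac (withDensity_absolutelyContinuous _ _) ?_)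
    rw [hmeas]
    exact withDensity_absolutelyContinuous _ _
  have hnorm : eLpNorm ξ 2 μ ^ 2 = 0 := by
    rw [eLpNorm_two_sq, ← setLIntegral_univ, ← withDensity_apply _ .univ, hzero]; rfl
  rw [← norm_eq_zero, Lp.norm_def, (pow_eq_zero_iff two_ne_zero).1 hnorm, ENNReal.toReal_zero]

/-- Up to null sets, `|f_a|²` is nonzero exactly on `Z(a)`, so the push-forward formula carries null
sets both ways. -/
theorem measure_eq_zero_iff (h : IsPathSystem μ f) (a : Λ) {E : Set (InfinitePath k Λ)}
    (hE : MeasurableSet E) :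
    μ (E ∩ cylinder (s a)) = 0 ↔ μ (shift (deg a) ⁻¹' E ∩ cylinder a) = 0 := by
  rw [← h.setLIntegral_shift_preimage a E hE,
    lintegral_eq_zero_iff' (((h.aestronglyMeasurable a).enorm.pow_const 2).restrict),
    Filter.EventuallyEq, ae_restrict_iff' (h.measurable_shift _ hE), measure_eq_zero_iff_ae_notMem]
  refine Filter.eventually_congr ?_
  filter_upwards [h.ae_eq_zero_of_notMem a, h.ae_ne_zero a] with x h1 h2
  by_cases hx : x ∈ cylinder a
  · simp [hx, h2 hx]
  · simp [hx, h1 hx]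

end IsPathSystem

/-- The absolutely continuous part of `μ` with respect to `ν` is the restriction of `μ` to a set of
full `ν`-measure, and has a square density. -/
theorem exists_sq_density {X : Type*} [MeasurableSpace X] (μ ν : Measure X) [IsFiniteMeasure μ]
    [IsFiniteMeasure ν] : ∃ (B : Set X) (w : X → ℝ≥0), MeasurableSet B ∧ Measurable w ∧
      ν Bᶜ = 0 ∧ ∀ E, MeasurableSet E → ∫⁻ x in E, ‖((w x : ℝ) : ℂ)‖ₑ ^ 2 ∂ν = μ (E ∩ B) := by
  -- `B` is null for the singular part of `μ` and its complement is `ν`-null, so restricting `μ` to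
  -- `B` leaves exactly the absolutely continuous part. `toNNReal` loses nothing, as the derivative
  -- is finite `ν`-a.e.
  obtain ⟨B, hB, hB0, hBc⟩ := Measure.mutuallySingular_singularPart μ ν
  refine ⟨B, fun x => NNReal.sqrt (μ.rnDeriv ν x).toNNReal, hB, ?_, hBc, fun E hE => ?_⟩
  · exact NNReal.continuous_sqrt.measurable.comp (Measure.measurable_rnDeriv μ ν).ennreal_toNNReal
  · calc ∫⁻ x in E, ‖((NNReal.sqrt (μ.rnDeriv ν x).toNNReal : ℝ) : ℂ)‖ₑ ^ 2 ∂ν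
        = ∫⁻ x in E, μ.rnDeriv ν x ∂ν := by
          refine setLIntegral_congr_fun_ae hE ?_
          filter_upwards [Measure.rnDeriv_lt_top μ ν] with x hx _
          have e : ‖((NNReal.sqrt (μ.rnDeriv ν x).toNNReal : ℝ) : ℂ)‖ₑ
              = (NNReal.sqrt (μ.rnDeriv ν x).toNNReal : ℝ≥0∞) := by
            rw [enorm_eq_nnnorm, Complex.nnnorm_real, NNReal.nnnorm_eq]
          rw [e, ← ENNReal.coe_pow, NNReal.sq_sqrt, ENNReal.coe_toNNReal hx.ne]
      _ = ∫⁻ x in E ∩ B, μ.rnDeriv ν x ∂ν := by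
          refine setLIntegral_congr ?_
          have hBae : ∀ᵐ x ∂ν, x ∈ B := by rwa [ae_iff]
          refine Filter.eventuallyEq_set.2 ?_
          filter_upwards [hBae] with x hx
          exact ⟨fun hxE => ⟨hxE, hx⟩, fun hxE => hxE.1⟩
      _ = (μ.singularPart ν + ν.withDensity (μ.rnDeriv ν)) (E ∩ B) := by
          rw [Measure.add_apply, measure_mono_null Set.inter_subset_right hB0, zero_add,
            withDensity_apply _ (hE.inter hB)]
      _ = μ (E ∩ B) := by rw [Measure.singularPart_add_rnDeriv]

/-! ### Disjoint representations force singular measures -/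

namespace IsPathSystem

open KGraph InfinitePath

variable {k : ℕ} {Λ : Type u} [KGraph k Λ] {μ μ' : Measure (InfinitePath k Λ)}
  {f f' : Λ → InfinitePath k Λ → ℂ} {B : Set (InfinitePath k Λ)} {w : InfinitePath k Λ → ℝ≥0}

/-- Each exceptional set is carried by the shift or by prefixing to a `μ'`-null set, using
quasi-invariance of `μ'`. Inside `B`, `μ'`-null implies `μ`-null. Points of `B` that leave `B`
already lie in `B`; points that enter `B` are first moved into `B` by the shift, then brought back
by quasi-invariance of `μ`. -/
theorem ae_mem_iff_shift_mem (h : IsPathSystem μ f) (h' : IsPathSystem μ' f')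
    (hB : MeasurableSet B) (hB0 : μ' Bᶜ = 0)
    (hac : ∀ E, MeasurableSet E → μ' E = 0 → μ (E ∩ B) = 0) (a : Λ) :
    ∀ᵐ x ∂μ, x ∈ cylinder a → (x ∈ B ↔ shift (deg a) x ∈ B) := by
  have hZ := measurableSet_cylinder (k := k) a
  have hσB := h.measurable_shift (deg a) hB
  have h1 : μ ((shift (deg a) ⁻¹' Bᶜ ∩ cylinder a) ∩ B) = 0 :=
    hac _ ((h.measurable_shift (deg a) hB.compl).inter hZ)
      ((h'.measure_eq_zero_iff a hB.compl).1 (measure_mono_null Set.inter_subset_left hB0))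
  have h2 : μ ((shift (deg a) ⁻¹' B ∩ cylinder a) \ B) = 0 := by
    have hE : MeasurableSet ((shift (deg a) ⁻¹' B ∩ cylinder a) \ B) := (hσB.inter hZ).diff hB
    have hF := h.measurableSet_image a hE
    have hFσ := image_prepend_preimage (k := k) a ((shift (deg a) ⁻¹' B ∩ cylinder a) \ B)
    rw [Set.inter_eq_left.2 (fun x hx => hx.1.2 :
      ((shift (deg a) ⁻¹' B ∩ cylinder a) \ B) ⊆ cylinder a)] at hFσ
    set F := Subtype.val '' (prepend (k := k) a ⁻¹'
      ((shift (deg a) ⁻¹' B ∩ cylinder a) \ B))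
    have hFB : F ⊆ B := by
      rintro _ ⟨y, hy, rfl⟩
      have := hy.1.1
      rwa [Set.mem_preimage, shift_prepend] at this
    have hμ' : μ' (shift (deg a) ⁻¹' F ∩ cylinder a) = 0 := by
      rw [hFσ]
      exact measure_mono_null (fun x hx => hx.2) hB0
    have h3 := hac _ (hF.inter (measurableSet_cylinder (s a))) ((h'.measure_eq_zero_iff a hF).2 hμ')
    rw [← hFσ, ← h.measure_eq_zero_iff a hF]
    exact measure_mono_null (Set.subset_inter subset_rfl fun x hx => hFB hx.1) h3
  filter_upwards [measure_eq_zero_iff_ae_notMem.1 h1, measure_eq_zero_iff_ae_notMem.1 h2]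
    with x hx1 hx2 hxa
  by_contra hcon
  by_cases hxB : x ∈ B
  · exact hx1 ⟨⟨fun hc => hcon ⟨fun _ => hc, fun _ => hxB⟩, hxa⟩, hxB⟩
  · refine hx2 ⟨⟨?_, hxa⟩, hxB⟩
    by_contra hc
    exact hcon ⟨fun h => (hxB h).elim, fun h => (hc h).elim⟩

theorem ae_eq_of_forall_setLIntegral_shift [IsFiniteMeasure μ] (h : IsPathSystem μ f) (a : Λ)
    {p q : InfinitePath k Λ → ℝ≥0∞} (hp : AEMeasurable p μ) (hq : AEMeasurable q μ)
    (hp0 : ∀ᵐ x ∂μ, x ∉ cylinder a → p x = 0) (hq0 : ∀ᵐ x ∂μ, x ∉ cylinder a → q x = 0)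
    (hpq : ∀ F, MeasurableSet F → ∫⁻ x in shift (deg a) ⁻¹' F, p x ∂μ =
      ∫⁻ x in shift (deg a) ⁻¹' F, q x ∂μ) : p =ᵐ[μ] q := by
  refine ae_eq_of_forall_setLIntegral_eq_of_sigmaFinite₀ hp hq fun E hE _ => ?_
  have hF := h.measurableSet_image a hE
  have key : ∀ {g : InfinitePath k Λ → ℝ≥0∞}, (∀ᵐ x ∂μ, x ∉ cylinder a → g x = 0) →
      ∫⁻ x in E, g x ∂μ =
        ∫⁻ x in shift (deg a) ⁻¹' (Subtype.val '' (prepend (k := k) a ⁻¹' E)), g x ∂μ := by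
    intro g hg
    rw [← lintegral_indicator hE, ← lintegral_indicator (h.measurable_shift _ hF)]
    refine lintegral_congr_ae ?_
    filter_upwards [hg] with x hx
    exact indicator_image_prepend_preimage a E hx
  rw [key hp0, key hq0, hpq _ hF]

/-- Over `σ^{-d(a)}(F)` the squares of both sides integrate to `μ(F ∩ Z(s(a)) ∩ B)`, and both vanish
off `Z(a)`. So the squares agree, and nonnegativity removes the phase. -/
theorem weight_identity (h : IsPathSystem μ f) (h' : IsPathSystem μ' f') (hfin : IsFinite Λ)
    (hf : ∀ a, ∀ᵐ x ∂μ, 0 ≤ f a x) (hf' : ∀ a, ∀ᵐ x ∂μ', 0 ≤ f' a x)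
    (hB : MeasurableSet B) (hw : Measurable w) (hB0 : μ' Bᶜ = 0)
    (hBw : ∀ E, MeasurableSet E → ∫⁻ x in E, ‖((w x : ℝ) : ℂ)‖ₑ ^ 2 ∂μ' = μ (E ∩ B)) (a : Λ) :
    (fun x => ((w x : ℝ) : ℂ) * f a x) =ᵐ[μ']
      fun x => f' a x * ((w (shift (deg a) x) : ℝ) : ℂ) := by
  have := h.isFiniteMeasure hfin
  have := h'.isFiniteMeasure hfin
  set W : InfinitePath k Λ → ℂ := fun x => ((w x : ℝ) : ℂ) with hW
  have hWm : Measurable W := Complex.measurable_ofReal.comp hw.coe_nnreal_real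
  have hW2 : Measurable fun x => ‖W x‖ₑ ^ 2 := hWm.enorm.pow_const 2
  -- Since `w² μ' ≤ μ`, facts true `μ`-a.e. hold `μ'`-a.e. where `w ≠ 0`. Elsewhere the factor `w`
  -- hides `f_a`.
  have htransfer : ∀ {p : InfinitePath k Λ → Prop}, (∀ᵐ x ∂μ, p x) →
      ∀ᵐ x ∂μ', W x ≠ 0 → p x := fun hp =>
    ae_weight_of_ae (φ := id) hWm.aestronglyMeasurable measurable_id
      (fun E hE => (hBw E hE).trans_le (measure_mono Set.inter_subset_left)) hp
  have hrestrict : (μ'.withDensity fun x => ‖W x‖ₑ ^ 2) = μ.restrict B := by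
    ext E hE
    rw [withDensity_apply _ hE, hBw E hE, Measure.restrict_apply hE]
  have hinv := h.ae_mem_iff_shift_mem h' hB hB0 (fun E hE hE0 => by
    rw [← hBw E hE, setLIntegral_measure_zero _ _ hE0]) a
  have hfm : AEMeasurable (fun x => ‖f a x‖ₑ ^ 2) μ := (h.aestronglyMeasurable a).enorm.pow_const 2
  have hfm' : AEMeasurable (fun x => ‖f' a x‖ₑ ^ 2) μ' :=
    (h'.aestronglyMeasurable a).enorm.pow_const 2
  -- `f_a` is only known to be a.e. measurable for `μ`, while the integrals below are against `μ'`;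
  -- hence a measurable representative of `|f_a|²`.
  set G := hfm.mk with hG
  have hGm : Measurable G := hfm.measurable_mk
  have hGf : (fun x => ‖f a x‖ₑ ^ 2) =ᵐ[μ] G := hfm.ae_eq_mk
  have hσ := h.measurable_shift (deg a)
  have hdens : (fun x => ‖W x‖ₑ ^ 2 * G x) =ᵐ[μ']
      fun x => ‖f' a x‖ₑ ^ 2 * ‖W (shift (deg a) x)‖ₑ ^ 2 := by
    refine h'.ae_eq_of_forall_setLIntegral_shift a (hW2.mul hGm).aemeasurable
      (hfm'.mul (hW2.comp hσ).aemeasurable) ?_ ?_ fun F hF => ?_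
    · filter_upwards [htransfer hGf, htransfer (h.ae_eq_zero_of_notMem a)] with x h1 h2 hxa
      by_cases hx : W x = 0
      · simp [hx]
      · rw [← h1 hx, h2 hx hxa]; simp
    · filter_upwards [h'.ae_eq_zero_of_notMem a] with x h1 hxa
      rw [h1 hxa]; simp
    · calc ∫⁻ x in shift (deg a) ⁻¹' F, ‖W x‖ₑ ^ 2 * G x ∂μ'
          = ∫⁻ x in shift (deg a) ⁻¹' F, G x ∂(μ'.withDensity fun x => ‖W x‖ₑ ^ 2) :=
            (setLIntegral_withDensity_eq_setLIntegral_mul _ hW2 hGm (hσ hF)).symm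
        _ = ∫⁻ x in shift (deg a) ⁻¹' F ∩ B, G x ∂μ := by
            rw [hrestrict, Measure.restrict_restrict (hσ hF)]
        _ = ∫⁻ x in shift (deg a) ⁻¹' F ∩ B, ‖f a x‖ₑ ^ 2 ∂μ :=
            lintegral_congr_ae (ae_restrict_of_ae hGf.symm)
        -- Shift-invariance of `B` on `Z(a)` moves `B` inside the preimage, so that the push-forward
        -- formula applies.
        _ = ∫⁻ x in shift (deg a) ⁻¹' (F ∩ B), ‖f a x‖ₑ ^ 2 ∂μ := by
            rw [← lintegral_indicator ((hσ hF).inter hB),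
              ← lintegral_indicator (hσ (hF.inter hB))]
            refine lintegral_congr_ae ?_
            filter_upwards [hinv, h.ae_eq_zero_of_notMem a] with x h1 h2
            by_cases hxa : x ∈ cylinder a
            · have e : x ∈ shift (deg a) ⁻¹' F ∩ B ↔ x ∈ shift (deg a) ⁻¹' (F ∩ B) :=
                and_congr_right fun _ => h1 hxa
              by_cases hx : x ∈ shift (deg a) ⁻¹' F ∩ B
              · rw [Set.indicator_of_mem hx, Set.indicator_of_mem (e.1 hx)]
              · rw [Set.indicator_of_notMem hx, Set.indicator_of_notMem (hx ∘ e.2)]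
            · rw [Set.indicator_apply_eq_zero.2 fun _ => by simp [h2 hxa],
                Set.indicator_apply_eq_zero.2 fun _ => by simp [h2 hxa]]
        _ = μ (F ∩ cylinder (s a) ∩ B) := by
            rw [h.setLIntegral_shift_preimage a _ (hF.inter hB), Set.inter_right_comm]
        _ = ∫⁻ x in F, ‖W x‖ₑ ^ 2 ∂(μ'.restrict (cylinder (s a))) := by
            rw [Measure.restrict_restrict hF, hBw _ (hF.inter (measurableSet_cylinder _))]
        _ = ∫⁻ x in F, ‖W x‖ₑ ^ 2 ∂((μ'.withDensity fun x => ‖f' a x‖ₑ ^ 2).map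
              (shift (deg a))) := by
            congr 2
            ext E hE
            rw [Measure.map_apply hσ hE, withDensity_apply _ (hσ hE),
              h'.setLIntegral_shift_preimage a E hE, Measure.restrict_apply hE]
        _ = ∫⁻ x in shift (deg a) ⁻¹' F, ‖W (shift (deg a) x)‖ₑ ^ 2
              ∂(μ'.withDensity fun x => ‖f' a x‖ₑ ^ 2) := setLIntegral_map hF hW2 hσ
        _ = ∫⁻ x in shift (deg a) ⁻¹' F, ‖f' a x‖ₑ ^ 2 * ‖W (shift (deg a) x)‖ₑ ^ 2 ∂μ' := by
            rw [restrict_withDensity (hσ hF), lintegral_withDensity_eq_lintegral_mul₀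
              hfm'.restrict (g := fun x => ‖W (shift (deg a) x)‖ₑ ^ 2)
              (hW2.comp hσ).aemeasurable]
            rfl
  have hW0 : ∀ x, 0 ≤ W x := fun x => Complex.zero_le_real.2 (w x).2
  filter_upwards [hdens, htransfer hGf, htransfer (hf a), hf' a] with x h1 h2 h3 h4
  have hnn : 0 ≤ W x * f a x := by
    by_cases hx : W x = 0
    · simp [hx]
    · exact mul_nonneg (hW0 x) (h3 hx)
  refine eq_of_nonneg_of_enorm_sq_eq hnn (mul_nonneg h4 (hW0 _)) ?_
  rw [enorm_mul, enorm_mul, mul_pow, mul_pow, ← h1]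
  change ‖W x‖ₑ ^ 2 * ‖f a x‖ₑ ^ 2 = ‖W x‖ₑ ^ 2 * G x
  by_cases hx : W x = 0
  · rw [hx, enorm_zero, zero_pow two_ne_zero, zero_mul, zero_mul]
  · rw [← h2 hx]

theorem mutuallySingular_of_areDisjoint (h : IsPathSystem μ f) (h' : IsPathSystem μ' f')
    (hfin : IsFinite Λ) (hf : ∀ a, ∀ᵐ x ∂μ, 0 ≤ f a x) (hf' : ∀ a, ∀ᵐ x ∂μ', 0 ≤ f' a x)
    {π : KGraphCStar k Λ →⋆ₙₐ[ℂ] (Lp ℂ 2 μ →L[ℂ] Lp ℂ 2 μ)}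
    {π' : KGraphCStar k Λ →⋆ₙₐ[ℂ] (Lp ℂ 2 μ' →L[ℂ] Lp ℂ 2 μ')}
    (hπ : IsAssociatedRep μ shift f π) (hπ' : IsAssociatedRep μ' shift f' π')
    (hd : AreDisjoint π π') : μ ⟂ₘ μ' := by
  have := h.isFiniteMeasure hfin
  have := h'.isFiniteMeasure hfin
  obtain ⟨B, w, hB, hw, hB0, hBw⟩ := exists_sq_density μ μ'
  have hWm : AEStronglyMeasurable (fun x => ((w x : ℝ) : ℂ)) μ' :=
    (Complex.measurable_ofReal.comp hw.coe_nnreal_real).aestronglyMeasurable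
  have hle : ∀ E, MeasurableSet E → ∫⁻ x in id ⁻¹' E, ‖((w x : ℝ) : ℂ)‖ₑ ^ 2 ∂μ' ≤ μ E :=
    fun E hE => (hBw E hE).trans_le (measure_mono Set.inter_subset_left)
  obtain ⟨W, hW⟩ := exists_isWeightedComp hWm measurable_id hle
  obtain ⟨P, hP⟩ := exists_isIndicatorMul μ hB
  have hnorm : ∀ ξ, ‖W ξ‖ = ‖P ξ‖ := fun ξ => norm_eq_of_eLpNorm_sq_eq (by
    rw [hW.eLpNorm_sq hWm measurable_id hBw, hP.eLpNorm_sq hB])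
  have hWP := adjoint_comp_self_eq_of_norm_eq W hP.isStarProjection hnorm
  have hpi : ∀ ξ, W (ContinuousLinearMap.adjoint W (W ξ)) = W ξ := by
    intro ξ
    have e1 : ContinuousLinearMap.adjoint W (W ξ) = P ξ := DFunLike.congr_fun hWP ξ
    have e2 : P (P ξ) = P ξ := DFunLike.congr_fun hP.isStarProjection.isIdempotentElem.eq ξ
    rw [e1, ← sub_eq_zero, ← map_sub, ← norm_eq_zero, hnorm, map_sub, e2, sub_self, norm_zero]
  have hgen : ∀ a ξ, W (π (KGraphCStar.gen k a) ξ) = π' (KGraphCStar.gen k a) (W ξ) := by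
    intro a ξ
    refine Lp.ext ?_
    filter_upwards [hW.apply_ae_eq hWm measurable_id hle (hπ a ξ),
      IsWeightedComp.apply_ae_eq (hπ' a) (h'.aestronglyMeasurable a) (h'.measurable_shift _)
        (h'.setLIntegral_shift_preimage_le a) (hW ξ),
      h.weight_identity h' hfin hf hf' hB hw hB0 hBw a] with x h1 h2 h3
    simp only [id_eq] at h1 h2
    rw [h1, h2, ← mul_assoc, h3, mul_assoc]
  have hind : ∀ {E : Set (InfinitePath k Λ)} {Q : Lp ℂ 2 μ →L[ℂ] Lp ℂ 2 μ}
      {Q' : Lp ℂ 2 μ' →L[ℂ] Lp ℂ 2 μ'}, IsIndicatorMul Q E → IsIndicatorMul Q' E →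
      ∀ ξ, W (Q ξ) = Q' (W ξ) := by
    intro E Q Q' hQ hQ' ξ
    refine Lp.ext ?_
    filter_upwards [hW.apply_ae_eq hWm measurable_id hle (hQ ξ), hQ' (W ξ), hW ξ] with x h1 h2 h3
    rw [h1, h2]
    by_cases hx : x ∈ E <;> simp [hx, h3]
  have hstar : ∀ a ξ, W (star (π (KGraphCStar.gen k a)) ξ) =
      star (π' (KGraphCStar.gen k a)) (W ξ) := by
    intro a ξ
    set S := fun a : Λ => π (KGraphCStar.gen k a) with hS
    set S' := fun a : Λ => π' (KGraphCStar.gen k a) with hS'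
    have hid : ∀ {H : Type u} [NormedAddCommGroup H] [InnerProductSpace ℂ H] [CompleteSpace H]
        {T : H →L[ℂ] H}, T * star T * T = T → ∀ ζ, star T (T (star T ζ)) = star T ζ := by
      intro H _ _ _ T hT ζ
      have e := congrArg star hT
      rw [star_mul, star_mul, star_star] at e
      exact DFunLike.congr_fun e ζ
    have c1 := h.isIndicatorMul_mul_star hfin hf hπ a
    have c2 := h'.isIndicatorMul_mul_star hfin hf' hπ' a
    have i1 : ∀ ζ, star (S a) (S a ζ) = S (s a) ζ :=
      DFunLike.congr_fun (h.star_mul_self_eq hfin hf hπ a)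
    have i2 : ∀ ζ, star (S' a) (S' a ζ) = S' (s a) ζ :=
      DFunLike.congr_fun (h'.star_mul_self_eq hfin hf' hπ' a)
    have e1 := hid (h.partialIsometry_eq hfin hf hπ a) ξ
    have e2 := hid (h'.partialIsometry_eq hfin hf' hπ' a) (W ξ)
    change W (star (S a) ξ) = star (S' a) (W ξ)
    -- Insert the initial projection `S_a* S_a = S_{s(a)}`, pass it through `W`, then trade `W S_a
    -- S_a*` for `S'_a S'_a* W`: both range projections are multiplication by `1_{Z(a)}`.
    calc W (star (S a) ξ) = W (S (s a) (star (S a) ξ)) := by rw [← i1]; exact congrArg W e1.symm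
      _ = star (S' a) (S' a (W (star (S a) ξ))) := by rw [i2]; exact hgen _ _
      _ = star (S' a) (W (S a (star (S a) ξ))) := congrArg _ (hgen a _).symm
      _ = star (S' a) (S' a (star (S' a) (W ξ))) := congrArg _ (hind c1 c2 ξ)
      _ = star (S' a) (W ξ) := e2
  have hW0 : W = 0 := by
    by_contra hne
    exact not_areDisjoint_of_intertwiner (intertwines_of_generators hgen hstar) hpi hne hd
  have hμB : μ B = 0 := by
    -- Testing on the constant function `1` gives `0 = ‖W 1‖² = μ(B)`.
    have e := hW.eLpNorm_sq hWm measurable_id hBw (indicatorConstLp 2 .univ (measure_ne_top μ _) 1)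
    rw [hW0, zero_apply, eLpNorm_congr_ae (Lp.coeFn_zero ℂ 2 μ'), eLpNorm_zero] at e
    have e2 : ∫⁻ x in B, ‖(indicatorConstLp 2 .univ (measure_ne_top μ Set.univ) (1 : ℂ) :
        InfinitePath k Λ → ℂ) x‖ₑ ^ 2 ∂μ = ∫⁻ x in B, 1 ∂μ := by
      refine lintegral_congr_ae (ae_restrict_of_ae ?_)
      filter_upwards [indicatorConstLp_coeFn (p := 2) (hs := .univ)
        (hμs := measure_ne_top μ Set.univ) (c := (1 : ℂ))] with x hx
      rw [hx]; simp
    rw [e2, setLIntegral_one] at e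
    simpa using e.symm
  exact ⟨B, hB, hμB, hB0⟩

end IsPathSystem

theorem mainTheorem7 {k : ℕ} {Λ : Type u} [KGraph k Λ]
    (hfin : KGraph.IsFinite Λ) (hsrc : KGraph.NoSources Λ)
    (μ μ' : Measure (InfinitePath k Λ)) (f f' : Λ → InfinitePath k Λ → ℂ)
    (h : IsProjectiveSystem μ (fun a : Λ => InfinitePath.cylinder (KGraph.s a))
      InfinitePath.prepend InfinitePath.shift f)
    (h' : IsProjectiveSystem μ' (fun a : Λ => InfinitePath.cylinder (KGraph.s a))
      InfinitePath.prepend InfinitePath.shift f')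
    (hf : ∀ a, ∀ᵐ x ∂μ, 0 ≤ f a x) (hf' : ∀ a, ∀ᵐ x ∂μ', 0 ≤ f' a x) :
    (∃! π, IsAssociatedRep μ InfinitePath.shift f π) ∧
    (∃! π', IsAssociatedRep μ' InfinitePath.shift f' π') ∧
    ∀ π π', IsAssociatedRep μ InfinitePath.shift f π →
      IsAssociatedRep μ' InfinitePath.shift f' π' →
        (AreDisjoint π π' ↔ μ ⟂ₘ μ') := by
  have hs : IsPathSystem μ f := h
  have hs' : IsPathSystem μ' f' := h'
  exact ⟨hs.existsUnique_rep hfin hf, hs'.existsUnique_rep hfin hf', fun π π' hπ hπ' =>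
    ⟨hs.mutuallySingular_of_areDisjoint hs' hfin hf hf' hπ hπ',
      hs.areDisjoint_of_mutuallySingular hs' hfin hf hf' hπ hπ'⟩⟩
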